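/- Let $(M^3,J)$ be a three-dimensional (strictly pseudoconvex) CR manifold: a smooth $3$-manifold with a smooth plane field $H\subset TM$ and a smooth, formally integrable complex structure $J\colon H\to H$. Let $\theta$ be a contact form on $M$, i.e. a smooth real one-form with $\ker\theta=H$ such that $d\theta(\cdot,J\cdot)$ is positive definite on $H$, and let $T$ be its Reeb field ($\theta(T)=1$, $T\lrcorner d\theta=0$). Let $T^{1,0}$ be the $i$-eigenspace of $J$ in $H\otimes\mathbb C$ and $T^{0,1}=\overline{T^{1,0}}$; a $(1,0)$-form is a complex one-form annihilating $T^{0,1}$, and the canonical bundle is $K=\Lambda^2(\Lambda^{1,0})$. An admissible coframe on an open set $U$ is a smooth $(1,0)$-form $\theta^1$ on $U$ with $\theta^1(T)=0$ whose restriction to $T^{1,0}$ is nowhere zero; write $\theta^{\bar 1}=\overline{\theta^1}$ and let $\{T,Z_1,Z_{\bar 1}\}$ be the frame dual to $\{\theta,\theta^1,\theta^{\bar 1}\}$. Then $d\theta=ih\,\theta^1\wedge\theta^{\bar 1}$ with $h>0$, and the Tanaka--Webster connection form $\omega=\omega_1{}^1$, torsion $A=A_{11}$ and real scalar curvature $R$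 are determined by $$d\theta^1=\theta^1\wedge\omega+h^{-1}\overline{A}\,\theta\wedge\theta^{\bar 1},\qquad h\omega+h\overline{\omega}=dh,\qquad d\omega\equiv R\,h\,\theta^1\wedge\theta^{\bar 1}\mod\theta .$$ The contact form $\theta$ is pseudo-Einstein if $\nabla_\alpha R-i\nabla^\beta A_{\alpha\beta}=0$, that is, if in every admissible coframe on every open set $$Z_1R-ih^{-1}\bigl(Z_{\bar 1}A-2\omega(Z_{\bar 1})A\bigr)=0 .$$ It is volume-normalized with respect to a nowhere vanishing section $\xi$ of $K$ if $\theta\wedge d\theta=i\,\theta\wedge(T\lrcorner\xi)\wedge(T\lrcorner\overline{\xi})$. Theorem. (a) $\theta$ is pseudo-Einstein if and only if for each point $p\in M$ there exist a neighborhood $U$ of $p$ and a smooth, nowhere vanishing, closed section of $K$ over $U$ with respect to which $\theta$ is volume-normalized on $U$. (b) $\theta$ is pseudo-Einstein if and only if, with respect to every admissible coframe on every open subset of $M$, the one-form $\omega_1{}^1+iR\theta$ is closed. -/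

import Mathlib

open scoped Manifold ContDiff TensorProduct ComplexConjugate
open Set

noncomputable section

namespace CR

/-! ### Exterior algebra on one tangent space -/

section Pointwise

variable {V : Type*} [AddCommGroup V] [Module ℝ V] [TopologicalSpace V]
variable {k : ℕ}

/-- The linear map underlying a `1`-form. -/
def toLin (α : V [⋀^Fin 1]→L[ℝ] ℂ) : V →ₗ[ℝ] ℂ :=
  (((ContinuousAlternatingMap.ofSubsingleton ℝ V ℂ (0 : Fin 1)).symm α : V →L[ℝ] ℂ) : V →ₗ[ℝ] ℂ)

theorem toLin_apply (α : V [⋀^Fin 1]→L[ℝ] ℂ) (v : V) : toLin α v = α ![v] := by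
  have : (fun _ : Fin 1 => v) = ![v] := by ext i; simp
  rw [← this]; rfl

/-- The complex-linear extension of a complex-valued `1`-form to the complexified space. -/
def ext (α : V [⋀^Fin 1]→L[ℝ] ℂ) : (ℂ ⊗[ℝ] V) →ₗ[ℂ] ℂ :=
  (toLin α).liftBaseChange ℂ

theorem ext_tmul (α : V [⋀^Fin 1]→L[ℝ] ℂ) (c : ℂ) (v : V) : ext α (c ⊗ₜ v) = c * α ![v] := by
  simp [ext, toLin_apply]

/-- The wedge product of a `1`-form with a `k`-form,
`(α ∧ β)(v₀, …, v_k) = ∑ᵢ (-1)ⁱ α(vᵢ) β(v₀, …, v̂ᵢ, …, v_k)`. -/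
def wedge (α : V [⋀^Fin 1]→L[ℝ] ℂ) (β : V [⋀^Fin k]→L[ℝ] ℂ) : V [⋀^Fin (k + 1)]→L[ℝ] ℂ :=
  { AlternatingMap.alternatizeUncurryFin ((toLin α).smulRight β.toAlternatingMap) with
    cont := by
      have h : ∀ i : Fin (k + 1), Continuous fun v : Fin (k + 1) → V =>
          (-1 : ℤ) ^ (i : ℕ) • (α ![v i] * β (i.removeNth v)) := by
        intro i
        refine Continuous.const_smul (Continuous.mul ?_ ?_) _
        · refine α.toContinuousMultilinearMap.cont.comp (continuous_pi fun j => ?_)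
          simpa [Subsingleton.elim j 0] using continuous_apply i
        · exact β.toContinuousMultilinearMap.cont.comp
            (continuous_pi fun j => continuous_apply (i.succAbove j))
      refine (continuous_finsetSum Finset.univ fun i _ => h i).congr fun v => ?_
      simp [AlternatingMap.alternatizeUncurryFin_apply, toLin_apply] }

theorem wedge_apply (α : V [⋀^Fin 1]→L[ℝ] ℂ) (β : V [⋀^Fin k]→L[ℝ] ℂ) (v : Fin (k + 1) → V) :
    wedge α β v = ∑ i : Fin (k + 1), (-1 : ℤ) ^ (i : ℕ) • (α ![v i] * β (i.removeNth v)) := by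
  change AlternatingMap.alternatizeUncurryFin ((toLin α).smulRight β.toAlternatingMap) v = _
  simp [AlternatingMap.alternatizeUncurryFin_apply, toLin_apply]

/-- The contraction `v ⌟ β = β(v, ⋅, …, ⋅)`. -/
def contract (v : V) (β : V [⋀^Fin (k + 1)]→L[ℝ] ℂ) : V [⋀^Fin k]→L[ℝ] ℂ :=
  { β.toAlternatingMap.curryLeft v with
    cont := β.toContinuousMultilinearMap.cont.comp
      (continuous_pi (Fin.cases continuous_const fun j => continuous_apply j)) }

theorem contract_apply (v : V) (β : V [⋀^Fin (k + 1)]→L[ℝ] ℂ) (w : Fin k → V) :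
    contract v β w = β (Matrix.vecCons v w) := rfl

/-- The complex conjugate of a complex-valued form. -/
def conjForm (β : V [⋀^Fin k]→L[ℝ] ℂ) : V [⋀^Fin k]→L[ℝ] ℂ :=
  (Complex.conjCLE : ℂ →L[ℝ] ℂ).compContinuousAlternatingMap β

/-- A real-valued form, regarded as a complex-valued one. -/
def ofRealForm (β : V [⋀^Fin k]→L[ℝ] ℝ) : V [⋀^Fin k]→L[ℝ] ℂ :=
  Complex.ofRealCLM.compContinuousAlternatingMap β

end Pointwise

/-! ### Vector fields and differential forms on a three-manifold -/

/-- The model space. -/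
abbrev E3 : Type := EuclideanSpace ℝ (Fin 3)

section Forms

variable (M : Type*) [TopologicalSpace M] [ChartedSpace E3 M]

/-- A (not necessarily smooth) vector field on `M`. -/
abbrev VField : Type _ := ∀ x : M, TangentSpace (𝓡 3) x

/-- A (not necessarily smooth) `k`-form on `M` with values in `F`. -/
abbrev Form (F : Type*) [NormedAddCommGroup F] [NormedSpace ℝ F] (k : ℕ) : Type _ :=
  ∀ x : M, TangentSpace (𝓡 3) x [⋀^Fin k]→L[ℝ] F

variable {M}
variable {F : Type*} [NormedAddCommGroup F] [NormedSpace ℝ F] {k : ℕ}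

/-- The vector field `X` is smooth on the open set `U`. -/
def VField.SmoothOn [IsManifold (𝓡 3) ∞ M] (X : VField M) (U : Set M) : Prop :=
  ContMDiffOn (𝓡 3) (𝓡 3).tangent ∞ (fun x => (⟨x, X x⟩ : TangentBundle (𝓡 3) M)) U

/-- The expression of the form `β` in the preferred chart `φ` at `p`, that is, `(φ⁻¹)^* β`.
It is meaningful on the target of the chart. -/
def Form.inChart (β : Form M F k) (p : M) : E3 → E3 [⋀^Fin k]→L[ℝ] F := fun y =>
  (β ((extChartAt (𝓡 3) p).symm y)).compContinuousLinearMap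
    (mfderiv 𝓘(ℝ, E3) (𝓡 3) (extChartAt (𝓡 3) p).symm y)

/-- The form `β` is smooth on the open set `U`. -/
def Form.SmoothOn (β : Form M F k) (U : Set M) : Prop :=
  ∀ p ∈ U, ContDiffAt ℝ ∞ (Form.inChart β p) (extChartAt (𝓡 3) p p)

/-- The exterior derivative: at `p` it is computed in the preferred chart at `p` and pulled back
to `M`. The normalization is `dα(X, Y) = X(α(Y)) - Y(α(X)) - α([X, Y])`. -/
def Form.d (β : Form M F k) : Form M F (k + 1) := fun p =>
  (extDeriv (Form.inChart β p) (extChartAt (𝓡 3) p p)).compContinuousLinearMap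
    (mfderiv (𝓡 3) 𝓘(ℝ, E3) (extChartAt (𝓡 3) p) p)

/-- The differential of a complex-valued function, as a `1`-form. -/
def dFun (f : M → ℂ) : Form M ℂ 1 := fun x =>
  ContinuousAlternatingMap.ofSubsingleton ℝ (TangentSpace (𝓡 3) x) ℂ (0 : Fin 1)
    (mfderiv (𝓡 3) 𝓘(ℝ, ℂ) f x)

/-- A complex-valued function that is smooth on the open set `U`. -/
def FunSmoothOn (f : M → ℂ) (U : Set M) : Prop := ContMDiffOn (𝓡 3) 𝓘(ℝ, ℂ) ∞ f U

end Forms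

/-! ### CR structures and contact forms -/

section CRManifold

variable {M : Type*} [TopologicalSpace M] [ChartedSpace E3 M] [IsManifold (𝓡 3) ∞ M]

variable (M) in
/-- A CR structure on a three-manifold: a smooth plane field `H ⊆ TM` with a smooth, formally
integrable complex structure `J : H → H`. (Nondegeneracy and strict pseudoconvexity are
expressed through a contact form, see `ContactForm`.) -/
structure CRStructure where
  /-- the plane field -/
  H : ∀ x : M, Submodule ℝ (TangentSpace (𝓡 3) x)
  /-- the complex structure -/
  J : ∀ x : M, H x →ₗ[ℝ] H x
  J_sq : ∀ (x : M) (v : H x), J x (J x v) = -v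
  /-- `H` has local frames of smooth vector fields. -/
  smooth_H : ∀ p : M, ∃ U : Set M, IsOpen U ∧ p ∈ U ∧ ∃ X Y : VField M,
    VField.SmoothOn X U ∧ VField.SmoothOn Y U ∧ ∀ x ∈ U,
      LinearIndependent ℝ ![X x, Y x] ∧ Submodule.span ℝ {X x, Y x} = H x
  /-- `J` maps smooth local sections of `H` to smooth local sections. -/
  smooth_J : ∀ (U : Set M) (X Y : VField M), IsOpen U → VField.SmoothOn X U →
    (∀ x ∈ U, ∃ h : X x ∈ H x, (J x ⟨X x, h⟩ : TangentSpace (𝓡 3) x) = Y x) →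
    VField.SmoothOn Y U
  /-- Formal integrability `[T^{1,0}, T^{1,0}] ⊆ T^{1,0}`: for local sections `X`, `Y` of `H`, with
  `X' = J X` and `Y' = J Y`, the field `[X - iX', Y - iY']` is a section of `T^{1,0}`, that is,
  `[X, Y] - [X', Y']` lies in `H` and is mapped by `J` to `[X', Y] + [X, Y']`. -/
  integrable : ∀ (U : Set M) (X Y X' Y' : VField M), IsOpen U →
    VField.SmoothOn X U → VField.SmoothOn Y U →
    (∀ x ∈ U, ∃ h : X x ∈ H x, (J x ⟨X x, h⟩ : TangentSpace (𝓡 3) x) = X' x) →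
    (∀ x ∈ U, ∃ h : Y x ∈ H x, (J x ⟨Y x, h⟩ : TangentSpace (𝓡 3) x) = Y' x) →
    ∀ x ∈ U, ∃ h : VectorField.mlieBracket (𝓡 3) X Y x - VectorField.mlieBracket (𝓡 3) X' Y' x
        ∈ H x,
      (J x ⟨_, h⟩ : TangentSpace (𝓡 3) x) =
        VectorField.mlieBracket (𝓡 3) X' Y x + VectorField.mlieBracket (𝓡 3) X Y' x

variable (S : CRStructure M)

/-- `T^{1,0}`, the `i`-eigenspace of `J` on `ℂ ⊗ H`, spanned by the vectors `v - i J v`. -/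
def CRStructure.T10 (x : M) : Submodule ℂ (ℂ ⊗[ℝ] TangentSpace (𝓡 3) x) :=
  Submodule.span ℂ (range fun v : S.H x =>
    (1 : ℂ) ⊗ₜ[ℝ] (v : TangentSpace (𝓡 3) x) -
      Complex.I ⊗ₜ[ℝ] (S.J x v : TangentSpace (𝓡 3) x))

/-- `T^{0,1}`, the conjugate of `T^{1,0}`, spanned by the vectors `v + i J v`. -/
def CRStructure.T01 (x : M) : Submodule ℂ (ℂ ⊗[ℝ] TangentSpace (𝓡 3) x) :=
  Submodule.span ℂ (range fun v : S.H x =>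
    (1 : ℂ) ⊗ₜ[ℝ] (v : TangentSpace (𝓡 3) x) +
      Complex.I ⊗ₜ[ℝ] (S.J x v : TangentSpace (𝓡 3) x))

/-- `Λ^{1,0}`: the complex covectors that annihilate `T^{0,1}`. -/
def CRStructure.Is10 (x : M) (α : TangentSpace (𝓡 3) x [⋀^Fin 1]→L[ℝ] ℂ) : Prop :=
  ∀ z ∈ S.T01 x, ext α z = 0

/-- The fibre of the canonical bundle `K = Λ²(Λ^{1,0})`. -/
def CRStructure.K (x : M) : Submodule ℂ (TangentSpace (𝓡 3) x [⋀^Fin 2]→L[ℝ] ℂ) :=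
  Submodule.span ℂ {ξ | ∃ α β : TangentSpace (𝓡 3) x [⋀^Fin 1]→L[ℝ] ℂ,
    S.Is10 x α ∧ S.Is10 x β ∧ ξ = wedge α β}

/-- A smooth section over `U` of the canonical bundle. -/
def CRStructure.IsCanonicalSection (U : Set M) (ξ : Form M ℂ 2) : Prop :=
  Form.SmoothOn ξ U ∧ ∀ x ∈ U, ξ x ∈ S.K x

/-- A contact form: a smooth real `1`-form `θ` with kernel `H` such that `dθ(⋅, J⋅)` is positive
definite on `H`. The existence of such a form means that the CR structure is strictly pseudoconvex
(in particular `H` is maximally nonintegrable) and that `M` is orientable. -/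
structure ContactForm where
  /-- the form -/
  form : Form M ℝ 1
  smooth : Form.SmoothOn form univ
  ker : ∀ (x : M) (v : TangentSpace (𝓡 3) x), form x ![v] = 0 ↔ v ∈ S.H x
  pos : ∀ (x : M) (v : S.H x), v ≠ 0 →
    0 < Form.d form x ![(v : TangentSpace (𝓡 3) x), (S.J x v : TangentSpace (𝓡 3) x)]

end CRManifold

section Pseudohermitian

variable {M : Type*} [TopologicalSpace M] [ChartedSpace E3 M] [IsManifold (𝓡 3) ∞ M] {S : CRStructure M}

/-- `θ` as a complex-valued form. -/
def ContactForm.toC (θ : ContactForm S) : Form M ℂ 1 := fun x => ofRealForm (θ.form x)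

/-- `dθ` as a complex-valued form. -/
def ContactForm.dC (θ : ContactForm S) : Form M ℂ 2 := fun x => ofRealForm (Form.d θ.form x)

/-- A covector that is not identically zero and an alternating bilinear form that is nonzero on a
basis `X, Y` of its kernel determine a unique vector. -/
theorem reeb_aux {V : Type*} [AddCommGroup V] [Module ℝ V] (t : V →ₗ[ℝ] ℝ)
    (B : V →ₗ[ℝ] V →ₗ[ℝ] ℝ) (hB : ∀ v, B v v = 0) (u X Y : V) (hu : t u ≠ 0)
    (hker : ∀ v, t v = 0 ↔ ∃ a b : ℝ, a • X + b • Y = v) (hXY : B X Y ≠ 0) :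
    ∃! T : V, t T = 1 ∧ ∀ v, B T v = 0 := by
  have hanti : ∀ v w, B v w = -B w v := by
    intro v w
    have h := hB (v + w)
    simp only [map_add, LinearMap.add_apply, hB] at h
    linarith
  have hX : t X = 0 := (hker X).2 ⟨1, 0, by simp⟩
  have hY : t Y = 0 := (hker Y).2 ⟨0, 1, by simp⟩
  have hYX : B Y X = -B X Y := hanti Y X
  have hdec : ∀ v, ∃ a b : ℝ, v = (t v / t u) • u + (a • X + b • Y) := by
    intro v
    obtain ⟨a, b, hab⟩ := (hker (v - (t v / t u) • u)).1 (by
      simp only [map_sub, map_smul, smul_eq_mul]; field_simp; ring)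
    exact ⟨a, b, by rw [hab]; abel⟩
  obtain ⟨u', hu'⟩ : ∃ u' : V, u' = (t u)⁻¹ • u := ⟨_, rfl⟩
  have htu' : t u' = 1 := by simp [hu', hu]
  refine ⟨u' + ((-(B u' Y) / B X Y) • X + (B u' X / B X Y) • Y), ⟨?_, ?_⟩, ?_⟩
  · simp [htu', hX, hY]
  · set T := u' + ((-(B u' Y) / B X Y) • X + (B u' X / B X Y) • Y) with hT
    have h1 : B T X = 0 := by
      simp only [hT, map_add, map_smul, LinearMap.add_apply, LinearMap.smul_apply, hB, hYX,
        smul_eq_mul]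
      field_simp; ring
    have h2 : B T Y = 0 := by
      simp only [hT, map_add, map_smul, LinearMap.add_apply, LinearMap.smul_apply, hB,
        smul_eq_mul]
      field_simp; ring
    have h3 : B T u' = 0 := by
      have h := hB T
      have h5 : B T T = B T u' + ((-(B u' Y) / B X Y) * B T X + (B u' X / B X Y) * B T Y) := by
        conv_lhs => rw [hT, ← hT]
        conv_lhs => arg 2; rw [hT]
        simp only [map_add, map_smul, smul_eq_mul]
      rw [h, h1, h2] at h5
      linarith
    have h4 : B T u = 0 := by
      have : u = t u • u' := by rw [hu', smul_smul, mul_inv_cancel₀ hu, one_smul]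
      rw [this, map_smul, h3, smul_zero]
    intro v
    obtain ⟨a, b, hv⟩ := hdec v
    rw [hv]
    simp only [map_add, map_smul, h1, h2, h4, smul_zero, add_zero]
  · rintro T' ⟨hT1, hT2⟩
    obtain ⟨a, b, hv⟩ := hdec T'
    rw [hT1, one_div, ← hu'] at hv
    have h1 := hT2 X
    have h2 := hT2 Y
    rw [hv] at h1 h2
    simp only [map_add, map_smul, LinearMap.add_apply, LinearMap.smul_apply, hB, hYX,
      smul_eq_mul] at h1 h2
    have ha : a = -(B u' Y) / B X Y := by field_simp; linarith
    have hb : b = B u' X / B X Y := by field_simp; linarith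
    rw [hv, ha, hb]

/-- The Reeb vector at each point exists and is unique. -/
theorem ContactForm.existsUnique_reeb (θ : ContactForm S) (x : M) :
    ∃! T : TangentSpace (𝓡 3) x, θ.form x ![T] = 1 ∧
      ∀ v : TangentSpace (𝓡 3) x, Form.d θ.form x ![T, v] = 0 := by
  classical
  set V := TangentSpace (𝓡 3) x
  have e1 : ∀ a b : V, Function.update ![a] 0 b = ![b] := fun a b => by
    ext i; fin_cases i; simp
  have e2 : ∀ a b c : V, Function.update ![a, c] 0 b = ![b, c] := fun a b c => by
    ext i; fin_cases i <;> simp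
  have e3 : ∀ a b c : V, Function.update ![a, c] 1 b = ![a, b] := fun a b c => by
    ext i; fin_cases i <;> simp
  let t : V →ₗ[ℝ] ℝ :=
    { toFun := fun v => θ.form x ![v]
      map_add' := fun v w => by
        have h := (θ.form x).map_update_add ![v] 0 v w
        simpa only [e1] using h
      map_smul' := fun c v => by
        rw [RingHom.id_apply]
        have h := (θ.form x).map_update_smul ![v] 0 c v
        simpa only [e1] using h }
  let B : V →ₗ[ℝ] V →ₗ[ℝ] ℝ := LinearMap.mk₂ ℝ (fun v w => Form.d θ.form x ![v, w])
    (fun v w z => by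
      have h := (Form.d θ.form x).map_update_add ![v, z] 0 v w
      simpa only [e2, e3] using h)
    (fun c v z => by
      have h := (Form.d θ.form x).map_update_smul ![v, z] 0 c v
      simpa only [e2, e3] using h)
    (fun v w z => by
      have h := (Form.d θ.form x).map_update_add ![v, w] 1 w z
      simpa only [e2, e3] using h)
    (fun c v z => by
      have h := (Form.d θ.form x).map_update_smul ![v, z] 1 c z
      simpa only [e2, e3] using h)
  have hB : ∀ v, B v v = 0 := fun v =>
    (Form.d θ.form x).map_eq_zero_of_eq ![v, v] (i := 0) (j := 1) (by simp) (by simp)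
  obtain ⟨U, -, hxU, X, Y, -, -, hXY⟩ := S.smooth_H x
  obtain ⟨hli, hspan⟩ := hXY x hxU
  have hmem : ∀ v : V, v ∈ S.H x ↔ ∃ a b : ℝ, a • X x + b • Y x = v := fun v => by
    rw [← hspan, Submodule.mem_span_pair]
  have hker : ∀ v : V, t v = 0 ↔ ∃ a b : ℝ, a • X x + b • Y x = v := fun v =>
    (θ.ker x v).trans (hmem v)
  have hXH : X x ∈ S.H x := (hmem _).2 ⟨1, 0, by simp⟩
  have hX0 : X x ≠ 0 := by simpa using hli.ne_zero 0
  have hB0 : B (X x) (Y x) ≠ 0 := by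
    intro h0
    obtain ⟨a, b, hab⟩ := (hmem _).1 (S.J x ⟨X x, hXH⟩).2
    have h := θ.pos x ⟨X x, hXH⟩ (fun h => hX0 (congrArg Subtype.val h))
    change 0 < B (X x) (S.J x ⟨X x, hXH⟩ : V) at h
    rw [← hab, map_add, map_smul, map_smul, hB, h0] at h
    simp at h
  have hu : ∃ u : V, t u ≠ 0 := by
    by_contra hcon
    push Not at hcon
    have htop : S.H x = ⊤ := by
      rw [eq_top_iff]
      intro v _
      exact (θ.ker x v).1 (hcon v)
    have h1 : Module.finrank ℝ (S.H x) = 2 := by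
      rw [← hspan]
      have := finrank_span_eq_card hli
      rw [show range ![X x, Y x] = {X x, Y x} by
        simp [Matrix.range_cons, Set.pair_comm]] at this
      simpa using this
    have h2 : Module.finrank ℝ V = 3 := by
      change Module.finrank ℝ E3 = 3
      simp
    rw [htop, finrank_top, h2] at h1
    omega
  obtain ⟨u, hu⟩ := hu
  exact reeb_aux t B hB u (X x) (Y x) hu hker hB0

/-- The Reeb vector field: `θ(T) = 1` and `T ⌟ dθ = 0`. -/
def ContactForm.reeb (θ : ContactForm S) : VField M := fun x =>
  (θ.existsUnique_reeb x).choose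

/-- `θ` is volume-normalized on `U` with respect to the section `ξ` of the canonical bundle:
`θ ∧ dθ = i θ ∧ (T ⌟ ξ) ∧ (T ⌟ ξ̄)`. -/
def ContactForm.VolumeNormalizedOn (θ : ContactForm S) (U : Set M) (ξ : Form M ℂ 2) : Prop :=
  ∀ x ∈ U, wedge (θ.toC x) (θ.dC x) =
    Complex.I • wedge (θ.toC x)
      (wedge (contract (θ.reeb x) (ξ x)) (contract (θ.reeb x) (conjForm (ξ x))))

/-- An admissible coframe `θ¹` over the open set `U`, together with its conjugate: a smooth
`(1,0)`-form that does not vanish on the line `T^{1,0}` and that annihilates the Reeb field. -/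
structure ContactForm.AdmissibleCoframe (θ : ContactForm S) (U : Set M) where
  /-- the form `θ¹` -/
  form : Form M ℂ 1
  smooth : Form.SmoothOn form U
  is10 : ∀ x ∈ U, S.Is10 x (form x)
  basis : ∀ x ∈ U, ∃ z ∈ S.T10 x, ext (form x) z ≠ 0
  reeb : ∀ x ∈ U, form x ![θ.reeb x] = 0

/-- The conjugate `θ^1̄` of the coframe form `θ¹`. -/
def ContactForm.AdmissibleCoframe.bar {θ : ContactForm S} {U : Set M} (e : θ.AdmissibleCoframe U) :
    Form M ℂ 1 := fun x => conjForm (e.form x)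

/-- The components, in the admissible coframe `θ¹`, of the Levi form, of the Tanaka-Webster
connection, and of its torsion and curvature. Each of them is uniquely determined on `U` by the
relation that defines it. -/
structure ContactForm.TanakaWebster (θ : ContactForm S) {U : Set M}
    (e : θ.AdmissibleCoframe U) where
  /-- the Levi form `h = h_{1 1̄}` -/
  h : M → ℝ
  /-- the complex vector fields `Z₁` and `Z_1̄` of the frame `T, Z₁, Z_1̄` dual to
  `θ, θ¹, θ^1̄` -/
  Z : ∀ x : M, ℂ ⊗[ℝ] TangentSpace (𝓡 3) x
  /-- see `Z` -/
  Zbar : ∀ x : M, ℂ ⊗[ℝ] TangentSpace (𝓡 3) x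
  /-- the connection form `ω_1^1` -/
  conn : Form M ℂ 1
  /-- the torsion component `A = A_{11}`, so that `τ_1 = A θ¹` and
  `τ^1 = h⁻¹ Ā θ^1̄` -/
  A : M → ℂ
  /-- the scalar curvature `R = R_1^1`, so that `R_{1 1̄} = R h` -/
  R : M → ℝ
  h_smooth : FunSmoothOn (fun x => (h x : ℂ)) U
  h_pos : ∀ x ∈ U, 0 < h x
  /-- `dθ = i h θ¹ ∧ θ^1̄` -/
  levi : ∀ x ∈ U, θ.dC x = (Complex.I * h x) • wedge (e.form x) (e.bar x)
  Z_dual : ∀ x ∈ U, ext (θ.toC x) (Z x) = 0 ∧ ext (e.form x) (Z x) = 1 ∧ ext (e.bar x) (Z x) = 0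
  Zbar_dual : ∀ x ∈ U,
    ext (θ.toC x) (Zbar x) = 0 ∧ ext (e.form x) (Zbar x) = 0 ∧ ext (e.bar x) (Zbar x) = 1
  conn_smooth : Form.SmoothOn conn U
  A_smooth : FunSmoothOn A U
  /-- `dθ¹ = θ¹ ∧ ω_1^1 + θ ∧ τ^1` -/
  structure_eq : ∀ x ∈ U, Form.d e.form x = wedge (e.form x) (conn x) +
    wedge (θ.toC x) (((h x : ℂ)⁻¹ * conj (A x)) • e.bar x)
  /-- `ω_{1 1̄} + ω_{1̄ 1} = dh` -/
  metric : ∀ x ∈ U, (h x : ℂ) • conn x + (h x : ℂ) • conjForm (conn x) = dFun (fun y => (h y : ℂ)) x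
  R_smooth : FunSmoothOn (fun x => (R x : ℂ)) U
  /-- `dω_1^1 = R_{1 1̄} θ¹ ∧ θ^1̄` modulo `θ` -/
  curvature : ∀ x ∈ U, ∃ η : TangentSpace (𝓡 3) x [⋀^Fin 1]→L[ℝ] ℂ,
    Form.d conn x = ((R x : ℂ) * h x) • wedge (e.form x) (e.bar x) + wedge (θ.toC x) η

namespace ContactForm.TanakaWebster

variable {θ : ContactForm S} {U : Set M} {e : θ.AdmissibleCoframe U} (D : θ.TanakaWebster e)

/-- `∇_1 R = Z₁ R`. -/
def gradR (x : M) : ℂ := ext (dFun (fun y => (D.R y : ℂ)) x) (D.Z x)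

/-- `∇^1 A_{11} = h⁻¹ ∇_1̄ A_{11}`, where
`∇_1̄ A_{11} = Z_1̄ A_{11} - 2 ω_1^1(Z_1̄) A_{11}`. -/
def divA (x : M) : ℂ :=
  (D.h x : ℂ)⁻¹ * (ext (dFun D.A x) (D.Zbar x) - 2 * ext (D.conn x) (D.Zbar x) * D.A x)

/-- The `1`-form `ω_1^1 + i R θ`. -/
def curvForm : Form M ℂ 1 := fun x => D.conn x + (Complex.I * D.R x) • θ.toC x

end ContactForm.TanakaWebster

/-- `θ` is pseudo-Einstein: `∇_α R - i ∇^β A_{αβ} = 0`, in every local admissible coframe. -/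
def ContactForm.PseudoEinstein (θ : ContactForm S) : Prop :=
  ∀ (U : Set M), IsOpen U → ∀ (e : θ.AdmissibleCoframe U) (D : θ.TanakaWebster e),
    ∀ x ∈ U, D.gradR x - Complex.I * D.divA x = 0

end Pseudohermitian

end CR

end

noncomputable section

namespace CR

/-! ### Exterior algebra of complex-valued forms on a three-dimensional space -/

section PointwiseAlgebra

variable {V : Type*} [AddCommGroup V] [Module ℝ V] [TopologicalSpace V] {k : ℕ}

/-! Everything rests on one formula. Write `E = ∇_1 R - i ∇^1 A_{11}`. Then `d(ω + iRθ) = -i E θ ∧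
θ¹ - i Ē θ ∧ θ^1̄`, with no `θ¹ ∧ θ^1̄` term (`TanakaWebster.d_curvForm`). The last term cancels
because `dω` contributes `R h` and `iR dθ` contributes `iR · ih`. The `θ ∧ θ^1̄` part of `dω` is
forced by `d(dθ¹) = 0` to be the conjugate divergence of the torsion, and the `θ ∧ θ¹` part follows
because `ω + ω̄ = d log h` makes `dω` imaginary (`TanakaWebster.d_conn`). Since `θ ∧ θ¹` and `θ ∧
θ^1̄` are independent, `ω + iRθ` is closed exactly where `E = 0`; this is (b).

For (a), a section of `K` has the form `ξ = u θ ∧ θ¹` in a coframe (`mem_K_iff`). Closedness of `ξ`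
is the single equation `u_1̄ = u ω_1̄` (`d_section`), and volume normalization is `h = |u|²`
(`volume_iff`).

If both hold and `u` has no zeros, metric compatibility supplies the `θ¹` component as well, so `ω +
iRθ - du/u = fθ` for some function `f`. Differentiating and comparing `θ¹ ∧ θ^1̄` terms gives `i f h
= 0`, hence `ω + iRθ = du/u`, which is closed (`d_curvForm_of_closed`).

Conversely, if `ω + iRθ` is closed, the Poincaré lemma (`exists_primitive`) writes it locally as
`dv`. Its real part is `½ d log h`, so `h e^{-v-v̄}` is a constant `C > 0`, and `u = √C e^v`
satisfies both equations (`PseudoEinstein.exists_section`). This direction needs a local admissible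
coframe (`exists_admissibleCoframe`) and its Tanaka-Webster data (`exists_tanakaWebster`).

Identities between forms are verified in a coframe: two sides agree once their values on a basis
agree, and what remains is polynomial algebra. -/

theorem wedge_one_apply (α β : V [⋀^Fin 1]→L[ℝ] ℂ) (v w : V) :
    wedge α β ![v, w] = α ![v] * β ![w] - α ![w] * β ![v] := by
  rw [wedge_apply, Fin.sum_univ_two]
  have h0 : (0 : Fin 2).removeNth ![v, w] = ![w] := by ext i; fin_cases i; rfl
  have h1 : (1 : Fin 2).removeNth ![v, w] = ![v] := by ext i; fin_cases i; rfl
  rw [h0, h1]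
  simp
  ring

theorem wedge_two_apply (α : V [⋀^Fin 1]→L[ℝ] ℂ) (β : V [⋀^Fin 2]→L[ℝ] ℂ) (u v w : V) :
    wedge α β ![u, v, w] = α ![u] * β ![v, w] - α ![v] * β ![u, w] + α ![w] * β ![u, v] := by
  rw [wedge_apply, Fin.sum_univ_three]
  have h0 : (0 : Fin 3).removeNth ![u, v, w] = ![v, w] := by ext i; fin_cases i <;> rfl
  have h1 : (1 : Fin 3).removeNth ![u, v, w] = ![u, w] := by ext i; fin_cases i <;> rfl
  have h2 : (2 : Fin 3).removeNth ![u, v, w] = ![u, v] := by ext i; fin_cases i <;> rfl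
  rw [h0, h1, h2]
  simp
  ring

@[simp] theorem conjForm_apply (β : V [⋀^Fin k]→L[ℝ] ℂ) (v : Fin k → V) :
    conjForm β v = conj (β v) := rfl

@[simp] theorem ofRealForm_apply (β : V [⋀^Fin k]→L[ℝ] ℝ) (v : Fin k → V) :
    ofRealForm β v = (β v : ℂ) := rfl

variable {G : Type*} [AddCommGroup G] [Module ℝ G] [TopologicalSpace G]

theorem form_swap (β : V [⋀^Fin 2]→L[ℝ] G) (v w : V) : β ![w, v] = -β ![v, w] := by
  have h := β.toAlternatingMap.map_swap ![v, w] (i := 0) (j := 1) (by decide)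
  have e : (![v, w] ∘ Equiv.swap (0 : Fin 2) 1) = ![w, v] := by
    ext i; fin_cases i <;> simp
  rw [e] at h
  exact h

theorem form_self (β : V [⋀^Fin 2]→L[ℝ] G) (v : V) : β ![v, v] = 0 :=
  β.map_eq_zero_of_eq ![v, v] (i := 0) (j := 1) rfl (by decide)

theorem form_one_add (α : V [⋀^Fin 1]→L[ℝ] G) (v w : V) : α ![v + w] = α ![v] + α ![w] :=
  α.vecCons_add ![] v w

theorem form_one_smul (α : V [⋀^Fin 1]→L[ℝ] G) (c : ℝ) (v : V) : α ![c • v] = c • α ![v] :=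
  α.vecCons_smul ![] c v

theorem form_one_ext (b : Module.Basis (Fin 3) ℝ V) {α β : V [⋀^Fin 1]→L[ℝ] G}
    (h : ∀ i, α ![b i] = β ![b i]) : α = β := by
  apply ContinuousAlternatingMap.toAlternatingMap_injective
  refine b.ext_alternating fun v _ => ?_
  have e : (fun i => b (v i)) = ![b (v 0)] := by ext i; fin_cases i; rfl
  rw [e]
  exact h _

theorem form_two_ext (b : Module.Basis (Fin 3) ℝ V) {α β : V [⋀^Fin 2]→L[ℝ] G}
    (h01 : α ![b 0, b 1] = β ![b 0, b 1]) (h02 : α ![b 0, b 2] = β ![b 0, b 2])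
    (h12 : α ![b 1, b 2] = β ![b 1, b 2]) : α = β := by
  apply ContinuousAlternatingMap.toAlternatingMap_injective
  refine b.ext_alternating fun v hv => ?_
  have e : (fun i => b (v i)) = ![b (v 0), b (v 1)] := by ext i; fin_cases i <;> rfl
  have hne : v 0 ≠ v 1 := fun h => absurd (hv h) (by decide)
  rw [e]
  change α _ = β _
  generalize v 0 = i at hne
  generalize v 1 = j at hne
  fin_cases i <;> fin_cases j
  · exact absurd rfl hne
  · exact h01
  · exact h02
  · change α ![b 1, b 0] = β ![b 1, b 0]
    rw [form_swap α, form_swap β, h01]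
  · exact absurd rfl hne
  · exact h12
  · change α ![b 2, b 0] = β ![b 2, b 0]
    rw [form_swap α, form_swap β, h02]
  · change α ![b 2, b 1] = β ![b 2, b 1]
    rw [form_swap α, form_swap β, h12]
  · exact absurd rfl hne

/-- Three distinct basis vectors are a permutation of the basis, and the permutation contributes the
same sign on both sides. -/
theorem form_three_ext (b : Module.Basis (Fin 3) ℝ V) {α β : V [⋀^Fin 3]→L[ℝ] G}
    (h : α ![b 0, b 1, b 2] = β ![b 0, b 1, b 2]) : α = β := by
  have e : ![b 0, b 1, b 2] = b := by ext i; fin_cases i <;> rfl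
  rw [e] at h
  apply ContinuousAlternatingMap.toAlternatingMap_injective
  refine b.ext_alternating fun v hv => ?_
  have hb : Function.Bijective v := Finite.injective_iff_bijective.1 hv
  set σ : Equiv.Perm (Fin 3) := Equiv.ofBijective v hb with hσ
  have e' : (fun i => b (v i)) = b ∘ σ := rfl
  rw [e', AlternatingMap.map_perm, AlternatingMap.map_perm]
  exact congrArg _ h

/-- A three-form is a multiple of any nonzero one. -/
theorem form_three_eq_smul (b : Module.Basis (Fin 3) ℝ V) (Ψ : V [⋀^Fin 3]→L[ℝ] ℂ)
    {Φ : V [⋀^Fin 3]→L[ℝ] ℂ} (hΦ : Φ ≠ 0) :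
    Φ ![b 0, b 1, b 2] ≠ 0 ∧ Ψ = (Ψ ![b 0, b 1, b 2] / Φ ![b 0, b 1, b 2]) • Φ := by
  have h : Φ ![b 0, b 1, b 2] ≠ 0 := fun h => hΦ (form_three_ext b (by simpa using h))
  refine ⟨h, form_three_ext b ?_⟩
  simp [h]

/-- Cramer's rule without denominators: on each `b i` it is the expansion of a `4 × 4` determinant
with a repeated column. No independence of the covectors is needed until one divides. -/
theorem form_one_cramer (b : Module.Basis (Fin 3) ℝ V) (β α₀ α₁ α₂ : V [⋀^Fin 1]→L[ℝ] ℂ) :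
    wedge α₀ (wedge α₁ α₂) ![b 0, b 1, b 2] • β =
      wedge β (wedge α₁ α₂) ![b 0, b 1, b 2] • α₀ +
      wedge α₀ (wedge β α₂) ![b 0, b 1, b 2] • α₁ +
      wedge α₀ (wedge α₁ β) ![b 0, b 1, b 2] • α₂ := by
  refine form_one_ext b fun i => ?_
  fin_cases i <;>
  · simp only [wedge_two_apply, wedge_one_apply, ContinuousAlternatingMap.add_apply,
      ContinuousAlternatingMap.smul_apply, smul_eq_mul, Fin.zero_eta, Fin.mk_one, Fin.reduceFinMk]
    ring

/-- The coefficient of `αᵢ ∧ αⱼ` is detected by wedging with the remaining covector; the middle sign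
comes from `α₁ ∧ α₀ ∧ α₂ = -α₀ ∧ α₁ ∧ α₂`. -/
theorem form_two_cramer (b : Module.Basis (Fin 3) ℝ V) (Ω : V [⋀^Fin 2]→L[ℝ] ℂ)
    (α₀ α₁ α₂ : V [⋀^Fin 1]→L[ℝ] ℂ) :
    wedge α₀ (wedge α₁ α₂) ![b 0, b 1, b 2] • Ω =
      wedge α₂ Ω ![b 0, b 1, b 2] • wedge α₀ α₁ +
      (-wedge α₁ Ω ![b 0, b 1, b 2]) • wedge α₀ α₂ +
      wedge α₀ Ω ![b 0, b 1, b 2] • wedge α₁ α₂ := by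
  apply form_two_ext b <;>
  · simp only [wedge_two_apply, wedge_one_apply, ContinuousAlternatingMap.add_apply,
      ContinuousAlternatingMap.smul_apply, smul_eq_mul]
    ring

theorem form_one_expand (b : Module.Basis (Fin 3) ℝ V) (β : V [⋀^Fin 1]→L[ℝ] ℂ)
    {α₀ α₁ α₂ : V [⋀^Fin 1]→L[ℝ] ℂ} (h : wedge α₀ (wedge α₁ α₂) ≠ 0) :
    ∃ c₀ c₁ c₂ : ℂ, β = c₀ • α₀ + c₁ • α₁ + c₂ • α₂ := by
  obtain ⟨hv, -⟩ := form_three_eq_smul b 0 h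
  have hc := congrArg (fun γ => (wedge α₀ (wedge α₁ α₂) ![b 0, b 1, b 2])⁻¹ • γ)
    (form_one_cramer b β α₀ α₁ α₂)
  simp only [smul_smul, inv_mul_cancel₀ hv, one_smul, smul_add] at hc
  exact ⟨_, _, _, hc⟩

theorem form_two_expand (b : Module.Basis (Fin 3) ℝ V) (Ω : V [⋀^Fin 2]→L[ℝ] ℂ)
    {α₀ α₁ α₂ : V [⋀^Fin 1]→L[ℝ] ℂ} (h : wedge α₀ (wedge α₁ α₂) ≠ 0) :
    ∃ c₀₁ c₀₂ c₁₂ : ℂ, Ω = c₀₁ • wedge α₀ α₁ + c₀₂ • wedge α₀ α₂ + c₁₂ • wedge α₁ α₂ := by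
  obtain ⟨hv, -⟩ := form_three_eq_smul b 0 h
  have hc := congrArg (fun γ => (wedge α₀ (wedge α₁ α₂) ![b 0, b 1, b 2])⁻¹ • γ)
    (form_two_cramer b Ω α₀ α₁ α₂)
  simp only [smul_smul, inv_mul_cancel₀ hv, one_smul, smul_add] at hc
  exact ⟨_, _, _, hc⟩

/-! Exterior algebra rules. -/

theorem wedge_add_right (α : V [⋀^Fin 1]→L[ℝ] ℂ) (β β' : V [⋀^Fin k]→L[ℝ] ℂ) :
    wedge α (β + β') = wedge α β + wedge α β' := by
  ext v; simp [wedge_apply, mul_add, Finset.sum_add_distrib]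

theorem wedge_smul_left (c : ℂ) (α : V [⋀^Fin 1]→L[ℝ] ℂ) (β : V [⋀^Fin k]→L[ℝ] ℂ) :
    wedge (c • α) β = c • wedge α β := by
  ext v
  simp only [wedge_apply, ContinuousAlternatingMap.smul_apply, smul_eq_mul, Finset.mul_sum]
  refine Finset.sum_congr rfl fun i _ => ?_
  simp only [zsmul_eq_mul]; ring

theorem wedge_smul_right (c : ℂ) (α : V [⋀^Fin 1]→L[ℝ] ℂ) (β : V [⋀^Fin k]→L[ℝ] ℂ) :
    wedge α (c • β) = c • wedge α β := by
  ext v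
  simp only [wedge_apply, ContinuousAlternatingMap.smul_apply, smul_eq_mul, Finset.mul_sum]
  refine Finset.sum_congr rfl fun i _ => ?_
  simp only [zsmul_eq_mul]; ring

theorem form_zero_smul (β : V [⋀^Fin k]→L[ℝ] ℂ) : (0 : ℂ) • β = 0 := by ext v; simp

theorem form_smul_zero (c : ℂ) : c • (0 : V [⋀^Fin k]→L[ℝ] ℂ) = 0 := by ext v; simp

theorem form_smul_eq_zero {c : ℂ} {β : V [⋀^Fin k]→L[ℝ] ℂ} (hc : c ≠ 0) (h : c • β = 0) :
    β = 0 := by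
  ext v
  have := congrArg (fun γ => γ v) h
  simpa [hc] using this

theorem conjForm_add (α β : V [⋀^Fin k]→L[ℝ] ℂ) :
    conjForm (α + β) = conjForm α + conjForm β := by ext v; simp

theorem conjForm_smul (c : ℂ) (α : V [⋀^Fin k]→L[ℝ] ℂ) :
    conjForm (c • α) = conj c • conjForm α := by ext v; simp

theorem conjForm_conjForm (α : V [⋀^Fin k]→L[ℝ] ℂ) : conjForm (conjForm α) = α := by ext v; simp

theorem conjForm_ofRealForm (α : V [⋀^Fin k]→L[ℝ] ℝ) :
    conjForm (ofRealForm α) = ofRealForm α := by ext v; simp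

theorem conjForm_wedge (α : V [⋀^Fin 1]→L[ℝ] ℂ) (β : V [⋀^Fin k]→L[ℝ] ℂ) :
    conjForm (wedge α β) = wedge (conjForm α) (conjForm β) := by
  ext v; simp [wedge_apply, map_sum]

theorem contract_conjForm (v : V) (β : V [⋀^Fin (k + 1)]→L[ℝ] ℂ) :
    contract v (conjForm β) = conjForm (contract v β) := rfl

theorem contract_smul (v : V) (c : ℂ) (β : V [⋀^Fin (k + 1)]→L[ℝ] ℂ) :
    contract v (c • β) = c • contract v β := rfl

theorem contract_wedge_one (v : V) (α β : V [⋀^Fin 1]→L[ℝ] ℂ) :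
    contract v (wedge α β) = α ![v] • β - β ![v] • α := by
  ext w
  have e : w = ![w 0] := by ext i; fin_cases i; rfl
  rw [contract_apply, e, wedge_one_apply]
  simp
  ring

theorem ext_add (α β : V [⋀^Fin 1]→L[ℝ] ℂ) (z : ℂ ⊗[ℝ] V) :
    ext (α + β) z = ext α z + ext β z := by
  induction z with
  | zero => simp
  | tmul c v => simp only [ext_tmul, ContinuousAlternatingMap.add_apply]; ring
  | add x y hx hy => simp only [map_add, hx, hy]; ring

theorem ext_smul (c : ℂ) (α : V [⋀^Fin 1]→L[ℝ] ℂ) (z : ℂ ⊗[ℝ] V) :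
    ext (c • α) z = c * ext α z := by
  induction z with
  | zero => simp
  | tmul c v => simp only [ext_tmul, ContinuousAlternatingMap.smul_apply, smul_eq_mul]; ring
  | add x y hx hy => simp only [map_add, hx, hy]; ring

end PointwiseAlgebra

/-! ### Exterior calculus on the model space -/

section FlatSpace

variable {F : Type*} [NormedAddCommGroup F] [NormedSpace ℝ F] {k : ℕ}
variable {n : WithTop ℕ∞} {y₀ : E3}

theorem contDiffAt_form_apply {γ : E3 → E3 [⋀^Fin k]→L[ℝ] F} (h : ContDiffAt ℝ n γ y₀)
    (v : Fin k → E3) : ContDiffAt ℝ n (fun y => γ y v) y₀ :=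
  (ContinuousAlternatingMap.apply ℝ E3 F v).contDiff.contDiffAt.comp y₀ h

/-- Evaluation of a form on arbitrary vectors in terms of the standard basis. -/
theorem form_apply_eq_sum (α : E3 [⋀^Fin k]→L[ℝ] F) (v : Fin k → E3) :
    α v = ∑ r : Fin k → Fin 3,
      (∏ i, v i (r i)) • α fun i => EuclideanSpace.basisFun (Fin 3) ℝ (r i) := by
  have hv : v = fun i => ∑ j, v i j • EuclideanSpace.basisFun (Fin 3) ℝ j := by
    ext i : 1
    exact ((EuclideanSpace.basisFun (Fin 3) ℝ).sum_repr (v i)).symm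
  conv_lhs => rw [hv]
  rw [α.map_sum]
  exact Finset.sum_congr rfl fun r _ => α.map_smul_univ _ _

/-- Expanding in the standard basis separates the moving vectors, which enter through their
coordinates, from the form, which is then evaluated on constant vectors only. -/
theorem contDiffAt_form_apply_apply {γ : E3 → E3 [⋀^Fin k]→L[ℝ] F} (h : ContDiffAt ℝ n γ y₀)
    {v : Fin k → E3 → E3} (hv : ∀ i, ContDiffAt ℝ n (v i) y₀) :
    ContDiffAt ℝ n (fun y => γ y fun i => v i y) y₀ := by
  simp_rw [fun y => form_apply_eq_sum (γ y) fun i => v i y]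
  refine ContDiffAt.sum fun r _ => ContDiffAt.smul (contDiffAt_prod fun i _ => ?_)
    (contDiffAt_form_apply h _)
  exact (EuclideanSpace.proj (𝕜 := ℝ) (r i)).contDiff.contDiffAt.comp y₀ (hv i)

theorem extDeriv_one_apply {γ : E3 → E3 [⋀^Fin 1]→L[ℝ] F} (h : DifferentiableAt ℝ γ y₀)
    (v w : E3) : extDeriv γ y₀ ![v, w] =
      fderiv ℝ (fun y => γ y ![w]) y₀ v - fderiv ℝ (fun y => γ y ![v]) y₀ w := by
  rw [extDeriv_apply h, Fin.sum_univ_two]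
  have h0 : (0 : Fin 2).removeNth ![v, w] = ![w] := by ext i; fin_cases i; rfl
  have h1 : (1 : Fin 2).removeNth ![v, w] = ![v] := by ext i; fin_cases i; rfl
  rw [h0, h1]
  simp [sub_eq_add_neg]

theorem extDeriv_two_apply {γ : E3 → E3 [⋀^Fin 2]→L[ℝ] F} (h : DifferentiableAt ℝ γ y₀)
    (u v w : E3) : extDeriv γ y₀ ![u, v, w] =
      fderiv ℝ (fun y => γ y ![v, w]) y₀ u - fderiv ℝ (fun y => γ y ![u, w]) y₀ v +
        fderiv ℝ (fun y => γ y ![u, v]) y₀ w := by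
  rw [extDeriv_apply h, Fin.sum_univ_three]
  have h0 : (0 : Fin 3).removeNth ![u, v, w] = ![v, w] := by ext i; fin_cases i <;> rfl
  have h1 : (1 : Fin 3).removeNth ![u, v, w] = ![u, w] := by ext i; fin_cases i <;> rfl
  have h2 : (2 : Fin 3).removeNth ![u, v, w] = ![u, v] := by ext i; fin_cases i <;> rfl
  rw [h0, h1, h2]
  simp [sub_eq_add_neg]

variable [FiniteDimensional ℝ F]

/-- Smoothness of a form is smoothness of its values on constant vectors. -/
theorem contDiffAt_form_iff {γ : E3 → E3 [⋀^Fin k]→L[ℝ] F} :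
    ContDiffAt ℝ n γ y₀ ↔ ∀ v : Fin k → E3, ContDiffAt ℝ n (fun y => γ y v) y₀ := by
  refine ⟨fun h v => contDiffAt_form_apply h v, fun h => ?_⟩
  let b : (Fin k → Fin 3) → Fin k → E3 := fun r i => EuclideanSpace.basisFun (Fin 3) ℝ (r i)
  let L : (E3 [⋀^Fin k]→L[ℝ] F) →ₗ[ℝ] ((Fin k → Fin 3) → F) :=
    { toFun := fun α r => α (b r)
      map_add' := fun _ _ => rfl
      map_smul' := fun _ _ => rfl }
  have hL : LinearMap.ker L = ⊥ := by
    refine LinearMap.ker_eq_bot'.2 fun α hα => ?_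
    ext v
    rw [form_apply_eq_sum]
    refine Finset.sum_eq_zero fun r _ => ?_
    have : α (b r) = 0 := congrFun hα r
    change _ • α (b r) = 0
    rw [this, smul_zero]
  obtain ⟨g, hg⟩ := L.exists_leftInverse_of_injective hL
  -- The left inverse `g` recovers the form from its finitely many components, each smooth by
  -- hypothesis.
  have hγ : γ = fun y => LinearMap.toContinuousLinearMap g (L (γ y)) := by
    ext1 y
    exact (LinearMap.congr_fun hg (γ y)).symm
  rw [hγ]
  exact (LinearMap.toContinuousLinearMap g).contDiff.contDiffAt.comp y₀
    (contDiffAt_pi.2 fun r => h (b r))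

theorem contDiffAt_form_pullback {γ : E3 → E3 [⋀^Fin k]→L[ℝ] F} {τ : E3 → E3}
    (hγ : ContDiffAt ℝ ∞ γ (τ y₀)) (hτ : ContDiffAt ℝ ∞ τ y₀) :
    ContDiffAt ℝ ∞ (fun y => (γ (τ y)).compContinuousLinearMap (fderiv ℝ τ y)) y₀ := by
  refine contDiffAt_form_iff.2 fun v => ?_
  have hd : ContDiffAt ℝ ∞ (fderiv ℝ τ) y₀ := hτ.fderiv_right (m := ∞) (by simp)
  exact contDiffAt_form_apply_apply (hγ.comp y₀ hτ) fun i => hd.clm_apply contDiffAt_const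

omit [FiniteDimensional ℝ F] in
theorem contDiffAt_extDeriv {γ : E3 → E3 [⋀^Fin k]→L[ℝ] F} (hγ : ContDiffAt ℝ ∞ γ y₀) :
    ContDiffAt ℝ ∞ (extDeriv γ) y₀ := by
  have e : extDeriv γ =
      ContinuousAlternatingMap.alternatizeUncurryFinCLM ℝ E3 F ∘ fderiv ℝ γ := by
    ext1 y
    exact (ContinuousAlternatingMap.alternatizeUncurryFinCLM_apply _).symm
  rw [e]
  exact (ContinuousAlternatingMap.alternatizeUncurryFinCLM ℝ E3 F).contDiff.contDiffAt.comp y₀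
    (hγ.fderiv_right (m := ∞) (by simp))

/-- The differential of a function on the model space, as a form. -/
def flatDFun (f : E3 → ℂ) (y : E3) : E3 [⋀^Fin 1]→L[ℝ] ℂ :=
  ContinuousAlternatingMap.ofSubsingleton ℝ E3 ℂ (0 : Fin 1) (fderiv ℝ f y)

theorem flatDFun_apply (f : E3 → ℂ) (y v : E3) : flatDFun f y ![v] = fderiv ℝ f y v := rfl

abbrev stdBasis : Module.Basis (Fin 3) ℝ E3 := (EuclideanSpace.basisFun (Fin 3) ℝ).toBasis

/-- This is `d(α ∧ β) = dα ∧ β - α ∧ dβ`. Because `wedge` takes a one-form on the left, `dα ∧ β`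
appears as `β ∧ dα`, which is equal since a two-form commutes with a one-form. -/
theorem extDeriv_wedge {α β : E3 → E3 [⋀^Fin 1]→L[ℝ] ℂ} (hα : ContDiffAt ℝ ∞ α y₀)
    (hβ : ContDiffAt ℝ ∞ β y₀) :
    extDeriv (fun y => wedge (α y) (β y)) y₀ =
      wedge (β y₀) (extDeriv α y₀) + (-1 : ℂ) • wedge (α y₀) (extDeriv β y₀) := by
  have dα := hα.differentiableAt (by simp)
  have dβ := hβ.differentiableAt (by simp)
  have ea : ∀ v, DifferentiableAt ℝ (fun y => α y ![v]) y₀ := fun v =>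
    (contDiffAt_form_apply hα ![v]).differentiableAt (by simp)
  have eb : ∀ v, DifferentiableAt ℝ (fun y => β y ![v]) y₀ := fun v =>
    (contDiffAt_form_apply hβ ![v]).differentiableAt (by simp)
  have dw : DifferentiableAt ℝ (fun y => wedge (α y) (β y)) y₀ := by
    refine ContDiffAt.differentiableAt (n := ∞) (contDiffAt_form_iff.2 fun v => ?_) (by simp)
    have e : v = ![v 0, v 1] := by ext i; fin_cases i <;> rfl
    rw [e]
    simp only [wedge_one_apply]
    have := contDiffAt_form_apply hα
    have := contDiffAt_form_apply hβ
    fun_prop (disch := assumption)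
  have key : ∀ v w u : E3, fderiv ℝ (fun y => wedge (α y) (β y) ![v, w]) y₀ u =
      (fderiv ℝ (fun y => α y ![v]) y₀ u * β y₀ ![w] + α y₀ ![v] * fderiv ℝ (fun y => β y ![w]) y₀ u)
      - (fderiv ℝ (fun y => α y ![w]) y₀ u * β y₀ ![v]
        + α y₀ ![w] * fderiv ℝ (fun y => β y ![v]) y₀ u) := by
    intro v w u
    simp only [wedge_one_apply]
    rw [fderiv_fun_sub ((ea v).fun_mul (eb w)) ((ea w).fun_mul (eb v)), fderiv_fun_mul (ea v) (eb w),
      fderiv_fun_mul (ea w) (eb v)]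
    simp only [_root_.sub_apply, _root_.add_apply,
      _root_.smul_apply, smul_eq_mul]
    ring
  refine form_three_ext stdBasis ?_
  rw [extDeriv_two_apply dw]
  simp only [key, ContinuousAlternatingMap.add_apply, ContinuousAlternatingMap.smul_apply,
    wedge_two_apply, extDeriv_one_apply dα, extDeriv_one_apply dβ, smul_eq_mul]
  ring

theorem extDeriv_smul_fun {f : E3 → ℂ} {α : E3 → E3 [⋀^Fin 1]→L[ℝ] ℂ}
    (hf : ContDiffAt ℝ ∞ f y₀) (hα : ContDiffAt ℝ ∞ α y₀) :
    extDeriv (fun y => f y • α y) y₀ =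
      wedge (flatDFun f y₀) (α y₀) + f y₀ • extDeriv α y₀ := by
  have dα := hα.differentiableAt (by simp)
  have df := hf.differentiableAt (by simp)
  have ea : ∀ v, DifferentiableAt ℝ (fun y => α y ![v]) y₀ := fun v =>
    (contDiffAt_form_apply hα ![v]).differentiableAt (by simp)
  have dw : DifferentiableAt ℝ (fun y => f y • α y) y₀ := df.smul dα
  have key : ∀ v u : E3, fderiv ℝ (fun y => (f y • α y) ![v]) y₀ u =
      fderiv ℝ f y₀ u * α y₀ ![v] + f y₀ * fderiv ℝ (fun y => α y ![v]) y₀ u := by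
    intro v u
    simp only [ContinuousAlternatingMap.smul_apply, smul_eq_mul]
    rw [fderiv_fun_mul df (ea v)]
    simp only [_root_.add_apply, _root_.smul_apply, smul_eq_mul]
    ring
  apply form_two_ext stdBasis <;>
  · rw [extDeriv_one_apply dw]
    rw [key, key]
    simp only [ContinuousAlternatingMap.add_apply, ContinuousAlternatingMap.smul_apply,
      wedge_one_apply, extDeriv_one_apply dα, smul_eq_mul, flatDFun_apply]
    ring

theorem two_le_infty : minSmoothness ℝ 2 ≤ (∞ : WithTop ℕ∞) := by
  rw [minSmoothness_of_isRCLikeNormedField]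
  exact WithTop.coe_le_coe.2 le_top

theorem extDeriv_flatDFun {f : E3 → ℂ} (hf : ContDiffAt ℝ ∞ f y₀) :
    extDeriv (flatDFun f) y₀ = 0 := by
  have e : flatDFun f = extDeriv fun y => ContinuousAlternatingMap.constOfIsEmpty ℝ E3 (Fin 0) (f y) := by
    ext1 y
    exact (extDeriv_constOfIsEmpty f y).symm
  rw [e]
  refine extDeriv_extDeriv_apply (r := ∞) (contDiffAt_form_iff.2 fun v => ?_) two_le_infty
  exact hf

omit [FiniteDimensional ℝ F] in
theorem contDiffAt_compLeft {G : Type*} [NormedAddCommGroup G] [NormedSpace ℝ G]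
    [FiniteDimensional ℝ G] (L : F →L[ℝ] G) {γ : E3 → E3 [⋀^Fin k]→L[ℝ] F}
    (hγ : ContDiffAt ℝ n γ y₀) :
    ContDiffAt ℝ n (fun y => L.compContinuousAlternatingMap (γ y)) y₀ :=
  contDiffAt_form_iff.2 fun v => L.contDiff.contDiffAt.comp y₀ (contDiffAt_form_apply hγ v)

omit [FiniteDimensional ℝ F] in
/-- Post-composition of forms with a linear map commutes with the exterior derivative. -/
theorem extDeriv_compLeft {G : Type*} [NormedAddCommGroup G] [NormedSpace ℝ G]
    [FiniteDimensional ℝ G] (L : F →L[ℝ] G) {γ : E3 → E3 [⋀^Fin k]→L[ℝ] F}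
    (h : ContDiffAt ℝ ∞ γ y₀) :
    extDeriv (fun y => L.compContinuousAlternatingMap (γ y)) y₀ =
      L.compContinuousAlternatingMap (extDeriv γ y₀) := by
  have hγ := h.differentiableAt (by simp)
  have dL := (contDiffAt_compLeft L h).differentiableAt (by simp)
  ext v
  rw [extDeriv_apply dL, ContinuousLinearMap.compContinuousAlternatingMap_coe, Function.comp_apply,
    extDeriv_apply hγ, map_sum]
  refine Finset.sum_congr rfl fun i _ => ?_
  have h := hγ.continuousAlternatingMap_apply_const (i.removeNth v)
  have := (L.hasFDerivAt.comp y₀ h.hasFDerivAt).fderiv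
  simp only [Function.comp_def] at this
  simp only [ContinuousLinearMap.compContinuousAlternatingMap_coe, Function.comp_def, this,
    map_zsmul]
  simp

end FlatSpace

/-! ### Chart independence of smoothness and of the exterior derivative -/

section ChartCalculus

open Filter Topology

variable {M : Type*} [TopologicalSpace M] [ChartedSpace E3 M]
variable {F : Type*} [NormedAddCommGroup F] [NormedSpace ℝ F] {k : ℕ}

/-- The point occurs in the type of `β x`, so it cannot simply be rewritten; every tangent space is
`E3` by definition, which allows the values to be compared. -/
theorem form_congr_point (β : Form M F k) {x x' : M} (h : x = x') {v w : Fin k → E3} (hvw : v = w) :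
    (show E3 [⋀^Fin k]→L[ℝ] F from β x) v = (show E3 [⋀^Fin k]→L[ℝ] F from β x') w := by
  subst h; subst hvw; rfl

/-- The chart of `M` at `p`, as a map to the model space. -/
abbrev chartMap (p : M) : M → E3 := extChartAt (𝓡 3) p

/-- The inverse of the chart of `M` at `p`. -/
abbrev chartInv (p : M) : E3 → M := (extChartAt (𝓡 3) p).symm

theorem chartInv_chartMap {p q : M} (hq : q ∈ (extChartAt (𝓡 3) p).source) :
    chartInv p (chartMap p q) = q := (extChartAt (𝓡 3) p).left_inv hq

theorem chartMap_chartInv {p : M} {y : E3} (hy : y ∈ (extChartAt (𝓡 3) p).target) :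
    chartMap p (chartInv p y) = y := (extChartAt (𝓡 3) p).right_inv hy

variable [IsManifold (𝓡 3) ∞ M]

theorem mdifferentiableAt_chartInv {p : M} {y : E3} (hy : y ∈ (extChartAt (𝓡 3) p).target) :
    MDifferentiableAt 𝓘(ℝ, E3) (𝓡 3) (chartInv p) y := by
  have := mdifferentiableWithinAt_extChartAt_symm (I := 𝓡 3) hy
  rwa [ModelWithCorners.range_eq_univ, mdifferentiableWithinAt_univ] at this

theorem mdifferentiableAt_chartMap {p q : M} (hq : q ∈ (extChartAt (𝓡 3) p).source) :
    MDifferentiableAt (𝓡 3) 𝓘(ℝ, E3) (chartMap p) q :=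
  mdifferentiableAt_extChartAt (by rwa [extChartAt_source] at hq)

/-- The derivative of the chart at `p`, at a point `q` of its domain. -/
def chartD (p q : M) : E3 →L[ℝ] E3 := mfderiv (𝓡 3) 𝓘(ℝ, E3) (chartMap p) q

/-- The derivative of the inverse of the chart at `p`. -/
def chartInvD (p : M) (y : E3) : E3 →L[ℝ] E3 := mfderiv 𝓘(ℝ, E3) (𝓡 3) (chartInv p) y

omit [IsManifold (𝓡 3) ∞ M] in
theorem inChart_apply (β : Form M F k) (p : M) (y : E3) (v : Fin k → E3) :
    Form.inChart β p y v =
      (show E3 [⋀^Fin k]→L[ℝ] F from β (chartInv p y)) fun i => chartInvD p y (v i) := rfl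

omit [IsManifold (𝓡 3) ∞ M] in
theorem d_apply (β : Form M F k) (p : M) (v : Fin (k + 1) → E3) :
    (show E3 [⋀^Fin (k + 1)]→L[ℝ] F from Form.d β p) v =
      extDeriv (Form.inChart β p) (chartMap p p) fun i => chartD p p (v i) := rfl

theorem chartInvD_chartD {p q : M} (hq : q ∈ (extChartAt (𝓡 3) p).source) (v : E3) :
    chartInvD p (chartMap p q) (chartD p q v) = v := by
  have h := mfderivWithin_extChartAt_symm_comp_mfderiv_extChartAt' (I := 𝓡 3) hq
  rw [ModelWithCorners.range_eq_univ, mfderivWithin_univ] at h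
  exact DFunLike.congr_fun h v

theorem chartD_self (p : M) (v : E3) : chartD p p v = v :=
  DFunLike.congr_fun (mfderiv_extChartAt_self (I := 𝓡 3) (x := p)) v

theorem chartInvD_self (p : M) (v : E3) : chartInvD p (chartMap p p) v = v := by
  conv_lhs => rw [← chartD_self p v]
  exact chartInvD_chartD (mem_extChartAt_source p) v

/-- The change of coordinates from the chart at `p` to the chart at `q`. -/
def transition (p q : M) : E3 → E3 := chartMap q ∘ chartInv p

theorem contDiffAt_transition {p q : M} {y : E3} (hy : y ∈ (extChartAt (𝓡 3) p).target)
    (hq : chartInv p y ∈ (extChartAt (𝓡 3) q).source) :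
    ContDiffAt ℝ ∞ (transition p q) y := by
  have h := contDiffWithinAt_ext_coord_change (n := ∞) (I := 𝓡 3) q p (y := y) ⟨hy, hq⟩
  rwa [ModelWithCorners.range_eq_univ, contDiffWithinAt_univ] at h

theorem fderiv_transition {p q : M} {y : E3} (hy : y ∈ (extChartAt (𝓡 3) p).target)
    (hq : chartInv p y ∈ (extChartAt (𝓡 3) q).source) (v : E3) :
    fderiv ℝ (transition p q) y v = chartD q (chartInv p y) (chartInvD p y v) := by
  rw [← mfderiv_eq_fderiv, transition, mfderiv_comp y (mdifferentiableAt_chartMap hq)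
    (mdifferentiableAt_chartInv hy)]
  rfl

/-- By the chain rule the transition has derivative `chartD q ∘ chartInvD p`, and composing with
`chartInvD q` cancels the first factor. -/
theorem inChart_eq_pullback (β : Form M F k) {p q : M} {y : E3}
    (hy : y ∈ (extChartAt (𝓡 3) p).target) (hq : chartInv p y ∈ (extChartAt (𝓡 3) q).source) :
    Form.inChart β p y = (Form.inChart β q (transition p q y)).compContinuousLinearMap
      (fderiv ℝ (transition p q) y) := by
  ext v
  rw [ContinuousAlternatingMap.compContinuousLinearMap_apply, inChart_apply, inChart_apply]
  refine form_congr_point β (chartInv_chartMap hq).symm (funext fun i => ?_)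
  rw [Function.comp_apply, fderiv_transition hy hq]
  exact (chartInvD_chartD hq _).symm

omit [IsManifold (𝓡 3) ∞ M] in
theorem eventually_chart {p : M} {y : E3} (hy : y ∈ (extChartAt (𝓡 3) p).target) :
    ∀ᶠ z in 𝓝 y, z ∈ (extChartAt (𝓡 3) p).target :=
  (isOpen_extChartAt_target p).mem_nhds hy

omit [IsManifold (𝓡 3) ∞ M] in
theorem continuousAt_chartInv {p : M} {y : E3} (hy : y ∈ (extChartAt (𝓡 3) p).target) :
    ContinuousAt (chartInv p) y :=
  continuousAt_extChartAt_symm'' hy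

omit [IsManifold (𝓡 3) ∞ M] in
theorem eventually_chartInv_mem {p : M} {y : E3} (hy : y ∈ (extChartAt (𝓡 3) p).target)
    {U : Set M} (hU : IsOpen U) (h : chartInv p y ∈ U) : ∀ᶠ z in 𝓝 y, chartInv p z ∈ U :=
  (continuousAt_chartInv hy).eventually (hU.mem_nhds h)

/-- A form is smooth at `p`, in the preferred chart at `p`. -/
def Form.SmoothAt (β : Form M F k) (p : M) : Prop :=
  ContDiffAt ℝ ∞ (Form.inChart β p) (chartMap p p)

variable [FiniteDimensional ℝ F]

/-- Smoothness does not depend on the chart. -/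
theorem Form.SmoothAt.inChart {β : Form M F k} {p : M} {y : E3}
    (hy : y ∈ (extChartAt (𝓡 3) p).target) (h : Form.SmoothAt β (chartInv p y)) :
    ContDiffAt ℝ ∞ (Form.inChart β p) y := by
  have hq := mem_extChartAt_source (I := 𝓡 3) (chartInv p y)
  have h1 : ContDiffAt ℝ ∞ (Form.inChart β (chartInv p y)) (transition p (chartInv p y) y) := h
  refine (contDiffAt_form_pullback h1 (contDiffAt_transition hy hq)).congr_of_eventuallyEq ?_
  filter_upwards [eventually_chart hy,
    eventually_chartInv_mem hy (isOpen_extChartAt_source _) hq] with z hz hz'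
  exact inChart_eq_pullback β hz hz'

omit [FiniteDimensional ℝ F] in
/-- In any chart, the exterior derivative on `M` is that of the model space. -/
theorem inChart_d {β : Form M F k} {p : M} {y : E3}
    (hy : y ∈ (extChartAt (𝓡 3) p).target) (h : Form.SmoothAt β (chartInv p y)) :
    Form.inChart (Form.d β) p y = extDeriv (Form.inChart β p) y := by
  set q := chartInv p y with hqd
  have hq : chartInv p y ∈ (extChartAt (𝓡 3) q).source := mem_extChartAt_source (I := 𝓡 3) _
  have h1 : ContDiffAt ℝ ∞ (Form.inChart β q) (transition p q y) := h
  have he : Form.inChart β p =ᶠ[𝓝 y] fun z => (Form.inChart β q (transition p q z)).compContinuousLinearMap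
      (fderiv ℝ (transition p q) z) := by
    filter_upwards [eventually_chart hy,
      eventually_chartInv_mem hy (isOpen_extChartAt_source _) hq] with z hz hz'
    exact inChart_eq_pullback β hz hz'
  -- `Form.d` at the point `q` is computed in the chart at `q`, so the comparison with the chart at
  -- `p` is naturality of `d` under the transition map.
  rw [he.extDeriv_eq, extDeriv_pullback (r := ∞) (h1.differentiableAt (by simp))
    (contDiffAt_transition hy hq) two_le_infty]
  ext v
  rw [inChart_apply, d_apply, ContinuousAlternatingMap.compContinuousLinearMap_apply]
  congr 1
  ext1 i
  rw [Function.comp_apply, fderiv_transition hy hq]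

theorem Form.SmoothAt.d {β : Form M F k} {U : Set M} (hU : IsOpen U)
    (h : ∀ x ∈ U, Form.SmoothAt β x) {p : M} (hp : p ∈ U) : Form.SmoothAt (Form.d β) p := by
  have hy := mem_extChartAt_target (I := 𝓡 3) p
  have hpp : chartInv p (chartMap p p) ∈ U := by rwa [chartInv_chartMap (mem_extChartAt_source p)]
  refine (contDiffAt_extDeriv (Form.SmoothAt.inChart hy (h _ hpp))).congr_of_eventuallyEq ?_
  filter_upwards [eventually_chart hy, eventually_chartInv_mem hy hU hpp] with z hz hz'
  exact inChart_d hz (h _ hz')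

omit [FiniteDimensional ℝ F] in
-- The preferred chart at `p` has identity derivative at `p`, so the pullback in the definition of
-- `Form.d` disappears and identities for `d` reduce to the model space.
theorem d_eq_iff {β : Form M F k} {p : M} {γ : TangentSpace (𝓡 3) p [⋀^Fin (k + 1)]→L[ℝ] F} :
    Form.d β p = γ ↔ extDeriv (Form.inChart β p) (chartMap p p) =
      (show E3 [⋀^Fin (k + 1)]→L[ℝ] F from γ) := by
  have e : (show E3 [⋀^Fin (k + 1)]→L[ℝ] F from Form.d β p) =
      extDeriv (Form.inChart β p) (chartMap p p) := by
    ext v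
    rw [d_apply]
    simp_rw [chartD_self]
  rw [← e]
  exact Iff.rfl

omit [FiniteDimensional ℝ F] in
theorem inChart_self (β : Form M F k) (p : M) :
    Form.inChart β p (chartMap p p) = (show E3 [⋀^Fin k]→L[ℝ] F from β p) := by
  ext v
  rw [inChart_apply]
  refine form_congr_point β (chartInv_chartMap (mem_extChartAt_source p)) (funext fun i => ?_)
  exact chartInvD_self p _

theorem d_d {β : Form M F k} {U : Set M} (hU : IsOpen U)
    (h : ∀ x ∈ U, Form.SmoothAt β x) {p : M} (hp : p ∈ U) : Form.d (Form.d β) p = 0 := by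
  have hy := mem_extChartAt_target (I := 𝓡 3) p
  have hpp : chartInv p (chartMap p p) ∈ U := by rwa [chartInv_chartMap (mem_extChartAt_source p)]
  rw [d_eq_iff]
  have he : Form.inChart (Form.d β) p =ᶠ[𝓝 (chartMap p p)] extDeriv (Form.inChart β p) := by
    filter_upwards [eventually_chart hy, eventually_chartInv_mem hy hU hpp] with z hz hz'
    exact inChart_d hz (h _ hz')
  rw [he.extDeriv_eq]
  exact extDeriv_extDeriv_apply (Form.SmoothAt.inChart hy (h _ hpp)) two_le_infty

omit [IsManifold (𝓡 3) ∞ M] [FiniteDimensional ℝ F] in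
theorem inChart_congr {β γ : Form M F k} {U : Set M} (hU : IsOpen U) (h : ∀ x ∈ U, β x = γ x)
    {p : M} {y : E3} (hy : y ∈ (extChartAt (𝓡 3) p).target) (hp : chartInv p y ∈ U) :
    Form.inChart β p =ᶠ[𝓝 y] Form.inChart γ p := by
  filter_upwards [eventually_chartInv_mem hy hU hp] with z hz
  ext v
  rw [inChart_apply, inChart_apply, h _ hz]

omit [IsManifold (𝓡 3) ∞ M] [FiniteDimensional ℝ F] in
theorem d_congr {β γ : Form M F k} {U : Set M} (hU : IsOpen U) (h : ∀ x ∈ U, β x = γ x)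
    {p : M} (hp : p ∈ U) : Form.d β p = Form.d γ p := by
  have := inChart_congr hU h (mem_extChartAt_target p)
    (by rwa [chartInv_chartMap (mem_extChartAt_source p)])
  rw [Form.d, Form.d, this.extDeriv_eq]

end ChartCalculus

/-! ### Smooth functions, operations on forms and Leibniz rules on the manifold -/

section FormOperations

open Filter Topology

variable {M : Type*} [TopologicalSpace M] [ChartedSpace E3 M] {k : ℕ}

/-! Expressions in charts. -/

theorem inChart_wedge (α : Form M ℂ 1) (β : Form M ℂ k) (p : M) :
    Form.inChart (fun x => wedge (α x) (β x)) p =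
      fun y => wedge (Form.inChart α p y) (Form.inChart β p y) := by
  ext y v
  rw [wedge_apply]
  refine (wedge_apply _ _ _).trans (Finset.sum_congr rfl fun i _ => ?_)
  rw [inChart_apply, inChart_apply]
  congr 3
  ext j
  fin_cases j
  rfl

theorem inChart_smul (f : M → ℂ) (β : Form M ℂ k) (p : M) :
    Form.inChart (fun x => f x • β x) p = fun y => f (chartInv p y) • Form.inChart β p y := rfl

theorem inChart_add (α β : Form M ℂ k) (p : M) :
    Form.inChart (fun x => α x + β x) p = fun y => Form.inChart α p y + Form.inChart β p y := rfl

theorem inChart_conj (β : Form M ℂ k) (p : M) :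
    Form.inChart (fun x => conjForm (β x)) p =
      fun y => (Complex.conjCLE : ℂ →L[ℝ] ℂ).compContinuousAlternatingMap (Form.inChart β p y) :=
  rfl

theorem inChart_ofReal (β : Form M ℝ k) (p : M) :
    Form.inChart (fun x => ofRealForm (β x)) p =
      fun y => Complex.ofRealCLM.compContinuousAlternatingMap (Form.inChart β p y) := rfl

/-! Functions. -/

/-- A complex-valued function that is smooth at `p`. -/
def FunSmoothAt (f : M → ℂ) (p : M) : Prop := ContMDiffAt (𝓡 3) 𝓘(ℝ, ℂ) ∞ f p

theorem funSmoothOn_iff {f : M → ℂ} {U : Set M} (hU : IsOpen U) :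
    FunSmoothOn f U ↔ ∀ p ∈ U, FunSmoothAt f p :=
  ⟨fun h p hp => (h p hp).contMDiffAt (hU.mem_nhds hp), fun h p hp => (h p hp).contMDiffWithinAt⟩

theorem FunSmoothAt.congr {f g : M → ℂ} {U : Set M} (hU : IsOpen U) (h : ∀ x ∈ U, f x = g x)
    {p : M} (hp : p ∈ U) (hg : FunSmoothAt g p) : FunSmoothAt f p :=
  ContMDiffAt.congr_of_eventuallyEq hg (by filter_upwards [hU.mem_nhds hp] with x hx using h x hx)

theorem funSmoothAt_const (c : ℂ) (p : M) : FunSmoothAt (fun _ => c) p := contMDiffAt_const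

theorem FunSmoothAt.comp_contDiffAt {f : M → ℂ} {p : M} {g : ℂ → ℂ} (hg : ContDiffAt ℝ ∞ g (f p))
    (hf : FunSmoothAt f p) : FunSmoothAt (fun x => g (f x)) p :=
  (hg.contMDiffAt).comp p hf

theorem FunSmoothAt.add {f g : M → ℂ} {p : M} (hf : FunSmoothAt f p) (hg : FunSmoothAt g p) :
    FunSmoothAt (fun x => f x + g x) p := ContMDiffAt.add hf hg

theorem FunSmoothAt.mul {f g : M → ℂ} {p : M} (hf : FunSmoothAt f p) (hg : FunSmoothAt g p) :
    FunSmoothAt (fun x => f x * g x) p :=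
  (contDiff_mul (𝕜 := ℝ) (𝔸 := ℂ)).contMDiff.contMDiffAt.comp p (ContMDiffAt.prodMk_space hf hg)

theorem FunSmoothAt.neg {f : M → ℂ} {p : M} (hf : FunSmoothAt f p) :
    FunSmoothAt (fun x => -f x) p := hf.comp_contDiffAt contDiff_neg.contDiffAt

theorem FunSmoothAt.conj {f : M → ℂ} {p : M} (hf : FunSmoothAt f p) :
    FunSmoothAt (fun x => conj (f x)) p :=
  hf.comp_contDiffAt (Complex.conjCLE : ℂ →L[ℝ] ℂ).contDiff.contDiffAt

theorem FunSmoothAt.inv {f : M → ℂ} {p : M} (hf : FunSmoothAt f p) (h0 : f p ≠ 0) :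
    FunSmoothAt (fun x => (f x)⁻¹) p :=
  hf.comp_contDiffAt (contDiffAt_inv ℝ h0)

theorem FunSmoothAt.cexp {f : M → ℂ} {p : M} (hf : FunSmoothAt f p) :
    FunSmoothAt (fun x => Complex.exp (f x)) p :=
  hf.comp_contDiffAt (Complex.contDiff_exp.contDiffAt)

/-- A function is smooth at `p` if it is so in the preferred chart. -/
theorem FunSmoothAt.of_chart {f : M → ℂ} {p : M}
    (h : ContDiffAt ℝ ∞ (fun y => f (chartInv p y)) (chartMap p p)) : FunSmoothAt f p := by
  have e : f =ᶠ[𝓝 p] (fun y => f (chartInv p y)) ∘ chartMap p := by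
    filter_upwards [extChartAt_source_mem_nhds (I := 𝓡 3) p] with x hx
    rw [Function.comp_apply, chartInv_chartMap hx]
  exact ((h.contMDiffAt).comp p contMDiffAt_extChartAt).congr_of_eventuallyEq e

variable [IsManifold (𝓡 3) ∞ M]

theorem FunSmoothAt.in_chart {f : M → ℂ} {p : M} {y : E3}
    (hy : y ∈ (extChartAt (𝓡 3) p).target) (h : FunSmoothAt f (chartInv p y)) :
    ContDiffAt ℝ ∞ (fun y => f (chartInv p y)) y := by
  have h1 : ContMDiffAt 𝓘(ℝ, E3) (𝓡 3) ∞ (chartInv p) y := by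
    have := contMDiffWithinAt_extChartAt_symm_range (I := 𝓡 3) (n := ∞) p hy
    rwa [ModelWithCorners.range_eq_univ, contMDiffWithinAt_univ] at this
  exact (ContMDiffAt.comp y h h1).contDiffAt

theorem FunSmoothAt.in_chart_self {f : M → ℂ} {p : M} (h : FunSmoothAt f p) :
    ContDiffAt ℝ ∞ (fun y => f (chartInv p y)) (chartMap p p) :=
  FunSmoothAt.in_chart (mem_extChartAt_target p)
    (by rwa [chartInv_chartMap (mem_extChartAt_source p)])

theorem inChart_dFun {f : M → ℂ} {p : M} {y : E3}
    (hy : y ∈ (extChartAt (𝓡 3) p).target) (h : FunSmoothAt f (chartInv p y)) :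
    Form.inChart (dFun f) p y = flatDFun (fun y => f (chartInv p y)) y := by
  ext v
  have e : v = ![v 0] := by ext i; fin_cases i; rfl
  rw [e, flatDFun_apply, ← mfderiv_eq_fderiv]
  have := mfderiv_comp y (h.mdifferentiableAt (by simp)) (mdifferentiableAt_chartInv hy)
  change _ = mfderiv 𝓘(ℝ, E3) 𝓘(ℝ, ℂ) (f ∘ chartInv p) y (v 0)
  rw [this]
  rfl

theorem dFun_eq {f : M → ℂ} {p : M} (h : FunSmoothAt f p) :
    dFun f p = flatDFun (fun y => f (chartInv p y)) (chartMap p p) := by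
  rw [← inChart_dFun (mem_extChartAt_target p)
    (by rwa [chartInv_chartMap (mem_extChartAt_source p)])]
  exact (inChart_self (dFun f) p).symm

theorem SmoothAt.dFun {f : M → ℂ} {U : Set M} (hU : IsOpen U)
    (h : ∀ x ∈ U, FunSmoothAt f x) {p : M} (hp : p ∈ U) : Form.SmoothAt (dFun f) p := by
  have hy := mem_extChartAt_target (I := 𝓡 3) p
  have hpp : chartInv p (chartMap p p) ∈ U := by rwa [chartInv_chartMap (mem_extChartAt_source p)]
  have h1 : ContDiffAt ℝ ∞ (flatDFun fun y => f (chartInv p y)) (chartMap p p) :=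
    contDiffAt_form_iff.2 fun v =>
      (((h p hp).in_chart_self.fderiv_right (m := ∞) (by simp)).clm_apply
        (contDiffAt_const (c := v 0)))
  refine h1.congr_of_eventuallyEq ?_
  filter_upwards [eventually_chart hy, eventually_chartInv_mem hy hU hpp] with z hz hz'
  exact inChart_dFun hz (h _ hz')

theorem d_dFun {f : M → ℂ} {U : Set M} (hU : IsOpen U)
    (h : ∀ x ∈ U, FunSmoothAt f x) {p : M} (hp : p ∈ U) : Form.d (dFun f) p = 0 := by
  have hy := mem_extChartAt_target (I := 𝓡 3) p
  have hpp : chartInv p (chartMap p p) ∈ U := by rwa [chartInv_chartMap (mem_extChartAt_source p)]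
  rw [d_eq_iff]
  have he : Form.inChart (dFun f) p =ᶠ[𝓝 (chartMap p p)] flatDFun fun y => f (chartInv p y) := by
    filter_upwards [eventually_chart hy, eventually_chartInv_mem hy hU hpp] with z hz hz'
    exact inChart_dFun hz (h _ hz')
  rw [he.extDeriv_eq]
  exact extDeriv_flatDFun (h p hp).in_chart_self

omit [IsManifold (𝓡 3) ∞ M] in
theorem dFun_congr {f g : M → ℂ} {U : Set M} (hU : IsOpen U) (h : ∀ x ∈ U, f x = g x)
    {p : M} (hp : p ∈ U) : dFun f p = dFun g p := by
  have : f =ᶠ[𝓝 p] g := by filter_upwards [hU.mem_nhds hp] with x hx using h x hx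
  rw [dFun, dFun, this.mfderiv_eq]

omit [IsManifold (𝓡 3) ∞ M] in
theorem flat_point (f : M → ℂ) (p : M) : f (chartInv p (chartMap p p)) = f p := by
  rw [chartInv_chartMap (mem_extChartAt_source p)]

theorem dFun_mul {f g : M → ℂ} {p : M} (hf : FunSmoothAt f p) (hg : FunSmoothAt g p) :
    dFun (fun x => f x * g x) p = g p • dFun f p + f p • dFun g p := by
  rw [dFun_eq (hf.mul hg), dFun_eq hf, dFun_eq hg]
  refine form_one_ext (V := E3) stdBasis fun i => ?_
  change flatDFun _ _ ![_] = g p • flatDFun _ _ ![_] + f p • flatDFun _ _ ![_]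
  rw [flatDFun_apply, flatDFun_apply, flatDFun_apply,
    fderiv_fun_mul (hf.in_chart_self.differentiableAt (by simp))
      (hg.in_chart_self.differentiableAt (by simp)), flat_point f p, flat_point g p]
  simp only [_root_.add_apply, _root_.smul_apply, smul_eq_mul]
  ring

theorem dFun_add {f g : M → ℂ} {p : M} (hf : FunSmoothAt f p) (hg : FunSmoothAt g p) :
    dFun (fun x => f x + g x) p = dFun f p + dFun g p := by
  rw [dFun_eq (hf.add hg), dFun_eq hf, dFun_eq hg]
  refine form_one_ext (V := E3) stdBasis fun i => ?_
  change flatDFun _ _ ![_] = flatDFun _ _ ![_] + flatDFun _ _ ![_]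
  rw [flatDFun_apply, flatDFun_apply, flatDFun_apply,
    fderiv_fun_add (hf.in_chart_self.differentiableAt (by simp))
      (hg.in_chart_self.differentiableAt (by simp))]
  rfl

theorem dFun_conj {f : M → ℂ} {p : M} (hf : FunSmoothAt f p) :
    dFun (fun x => conj (f x)) p = conjForm (dFun f p) := by
  rw [dFun_eq hf.conj, dFun_eq hf]
  refine form_one_ext (V := E3) stdBasis fun i => ?_
  change flatDFun _ _ ![_] = conj (flatDFun _ _ ![_])
  rw [flatDFun_apply, flatDFun_apply]
  have := ((Complex.conjCLE : ℂ →L[ℝ] ℂ).hasFDerivAt.comp (chartMap p p)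
    (hf.in_chart_self.differentiableAt (by simp)).hasFDerivAt).fderiv
  exact DFunLike.congr_fun this _

theorem dFun_cexp {f : M → ℂ} {p : M} (hf : FunSmoothAt f p) :
    dFun (fun x => Complex.exp (f x)) p = Complex.exp (f p) • dFun f p := by
  rw [dFun_eq hf.cexp, dFun_eq hf]
  refine form_one_ext (V := E3) stdBasis fun i => ?_
  change flatDFun _ _ ![_] = Complex.exp (f p) • flatDFun _ _ ![_]
  rw [flatDFun_apply, flatDFun_apply,
    ((hf.in_chart_self.differentiableAt (by simp)).hasFDerivAt.cexp).fderiv, flat_point f p]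
  rfl

omit [IsManifold (𝓡 3) ∞ M] in
theorem dFun_const (c : ℂ) (p : M) : dFun (fun _ : M => c) p = 0 := by
  rw [dFun, mfderiv_const]
  rfl

/-! Smoothness of forms and rules for the exterior derivative. -/

omit [IsManifold (𝓡 3) ∞ M] in
theorem Form.SmoothAt.wedge_one {α β : Form M ℂ 1} {p : M} (hα : Form.SmoothAt α p)
    (hβ : Form.SmoothAt β p) : Form.SmoothAt (fun x => wedge (α x) (β x)) p := by
  unfold Form.SmoothAt
  rw [inChart_wedge]
  refine contDiffAt_form_iff.2 fun v => ?_
  have e : v = ![v 0, v 1] := by ext i; fin_cases i <;> rfl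
  rw [e]
  simp only [wedge_one_apply]
  have := contDiffAt_form_apply hα
  have := contDiffAt_form_apply hβ
  fun_prop (disch := assumption)

omit [IsManifold (𝓡 3) ∞ M] in
theorem Form.SmoothAt.wedge_two {α : Form M ℂ 1} {β : Form M ℂ 2} {p : M}
    (hα : Form.SmoothAt α p) (hβ : Form.SmoothAt β p) :
    Form.SmoothAt (fun x => wedge (α x) (β x)) p := by
  unfold Form.SmoothAt
  rw [inChart_wedge]
  refine contDiffAt_form_iff.2 fun v => ?_
  have e : v = ![v 0, v 1, v 2] := by ext i; fin_cases i <;> rfl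
  rw [e]
  simp only [wedge_two_apply]
  have := contDiffAt_form_apply hα
  have := contDiffAt_form_apply hβ
  fun_prop (disch := assumption)

theorem Form.SmoothAt.smul {f : M → ℂ} {β : Form M ℂ k} {p : M} (hf : FunSmoothAt f p)
    (hβ : Form.SmoothAt β p) : Form.SmoothAt (fun x => f x • β x) p :=
  ContDiffAt.smul hf.in_chart_self hβ

omit [IsManifold (𝓡 3) ∞ M] in
theorem Form.SmoothAt.add {α β : Form M ℂ k} {p : M} (hα : Form.SmoothAt α p)
    (hβ : Form.SmoothAt β p) : Form.SmoothAt (fun x => α x + β x) p :=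
  ContDiffAt.add hα hβ

omit [IsManifold (𝓡 3) ∞ M] in
theorem Form.SmoothAt.conj {β : Form M ℂ k} {p : M} (hβ : Form.SmoothAt β p) :
    Form.SmoothAt (fun x => conjForm (β x)) p :=
  contDiffAt_compLeft (Complex.conjCLE : ℂ →L[ℝ] ℂ) hβ

omit [IsManifold (𝓡 3) ∞ M] in
theorem Form.SmoothAt.ofReal {β : Form M ℝ k} {p : M} (hβ : Form.SmoothAt β p) :
    Form.SmoothAt (fun x => ofRealForm (β x)) p :=
  contDiffAt_compLeft Complex.ofRealCLM hβ

theorem d_wedge {α β : Form M ℂ 1} {p : M} (hα : Form.SmoothAt α p) (hβ : Form.SmoothAt β p) :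
    Form.d (fun x => wedge (α x) (β x)) p =
      wedge (β p) (Form.d α p) + (-1 : ℂ) • wedge (α p) (Form.d β p) := by
  rw [d_eq_iff, inChart_wedge, extDeriv_wedge hα hβ, inChart_self, inChart_self,
    d_eq_iff.1 (rfl : Form.d α p = Form.d α p), d_eq_iff.1 (rfl : Form.d β p = Form.d β p)]
  rfl

theorem d_smul {f : M → ℂ} {α : Form M ℂ 1} {p : M} (hf : FunSmoothAt f p)
    (hα : Form.SmoothAt α p) :
    Form.d (fun x => f x • α x) p = wedge (dFun f p) (α p) + f p • Form.d α p := by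
  rw [d_eq_iff, inChart_smul, extDeriv_smul_fun hf.in_chart_self hα, inChart_self,
    d_eq_iff.1 (rfl : Form.d α p = Form.d α p), dFun_eq hf, flat_point f p]
  rfl

theorem d_add {α β : Form M ℂ k} {p : M} (hα : Form.SmoothAt α p) (hβ : Form.SmoothAt β p) :
    Form.d (fun x => α x + β x) p = Form.d α p + Form.d β p := by
  rw [d_eq_iff, inChart_add, extDeriv_fun_add (ContDiffAt.differentiableAt hα (by simp))
    (ContDiffAt.differentiableAt hβ (by simp)),
    d_eq_iff.1 (rfl : Form.d α p = Form.d α p), d_eq_iff.1 (rfl : Form.d β p = Form.d β p)]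
  rfl

theorem d_conj {β : Form M ℂ k} {p : M} (hβ : Form.SmoothAt β p) :
    Form.d (fun x => conjForm (β x)) p = conjForm (Form.d β p) := by
  rw [d_eq_iff, inChart_conj, extDeriv_compLeft _ hβ,
    d_eq_iff.1 (rfl : Form.d β p = Form.d β p)]
  rfl

theorem d_ofReal {β : Form M ℝ k} {p : M} (hβ : Form.SmoothAt β p) :
    Form.d (fun x => ofRealForm (β x)) p = ofRealForm (Form.d β p) := by
  rw [d_eq_iff, inChart_ofReal, extDeriv_compLeft _ hβ,
    d_eq_iff.1 (rfl : Form.d β p = Form.d β p)]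
  rfl

end FormOperations

/-! ### Admissible coframes and components of forms -/

section Coframes

open Filter Topology

variable {M : Type*} [TopologicalSpace M] [ChartedSpace E3 M]

/-- The standard basis of a tangent space, in the preferred chart at the point. -/
def tangentBasis (x : M) : Module.Basis (Fin 3) ℝ (TangentSpace (𝓡 3) x) := stdBasis

variable [IsManifold (𝓡 3) ∞ M]

/-- The ratio of two smooth proportional forms is smooth. -/
theorem FunSmoothAt.of_forms {k : ℕ} {Ψ Φ : Form M ℂ k} {f : M → ℂ} {U : Set M} (hU : IsOpen U)
    (h : ∀ x ∈ U, Ψ x = f x • Φ x) {p : M} (hp : p ∈ U) (hΨ : Form.SmoothAt Ψ p)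
    (hΦ : Form.SmoothAt Φ p) (h0 : Φ p ≠ 0) : FunSmoothAt f p := by
  have hpp : chartInv p (chartMap p p) ∈ U := by rwa [chartInv_chartMap (mem_extChartAt_source p)]
  -- On a constant family `v` where `Φ` does not vanish at `p`, hence nearby, `f` is the quotient of
  -- the values of `Ψ` and `Φ`.
  obtain ⟨v, hv⟩ : ∃ v, Form.inChart Φ p (chartMap p p) v ≠ 0 := by
    by_contra hcon
    push Not at hcon
    apply h0
    have h1 := inChart_self Φ p
    rw [show Form.inChart Φ p (chartMap p p) = 0 by ext v; exact hcon v] at h1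
    exact h1.symm
  have h1 := contDiffAt_form_apply hΨ v
  have h2 := contDiffAt_form_apply hΦ v
  refine FunSmoothAt.of_chart ((h1.mul (h2.inv hv)).congr_of_eventuallyEq ?_)
  filter_upwards [eventually_chartInv_mem (mem_extChartAt_target p) hU hpp,
    h2.continuousAt.eventually_ne hv] with y hy hne
  change f (chartInv p y) = Form.inChart Ψ p y v * (Form.inChart Φ p y v)⁻¹
  rw [eq_mul_inv_iff_mul_eq₀ hne, inChart_apply, inChart_apply, h _ hy]
  rfl

variable {S : CRStructure M}

/-- On a generator `v + iJv` of `T^{0,1}` the extension of `α` is `α(v) + iα(Jv)`. The criterion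
uses real vectors only. -/
theorem CRStructure.is10_iff {x : M} {α : TangentSpace (𝓡 3) x [⋀^Fin 1]→L[ℝ] ℂ} :
    S.Is10 x α ↔ ∀ v : S.H x, α ![(S.J x v : TangentSpace (𝓡 3) x)] =
      Complex.I * α ![(v : TangentSpace (𝓡 3) x)] := by
  have key : ∀ v : S.H x, ext α ((1 : ℂ) ⊗ₜ[ℝ] (v : TangentSpace (𝓡 3) x) +
      Complex.I ⊗ₜ[ℝ] (S.J x v : TangentSpace (𝓡 3) x)) = 0 ↔
      α ![(S.J x v : TangentSpace (𝓡 3) x)] = Complex.I * α ![(v : TangentSpace (𝓡 3) x)] := by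
    intro v
    rw [map_add, ext_tmul, ext_tmul]
    constructor
    · intro h
      linear_combination (-Complex.I) * h + α ![(S.J x v : TangentSpace (𝓡 3) x)] * Complex.I_mul_I
    · intro h
      rw [h]
      linear_combination α ![(v : TangentSpace (𝓡 3) x)] * Complex.I_mul_I
  constructor
  · exact fun h v => (key v).1 (h _ (Submodule.subset_span ⟨v, rfl⟩))
  · intro h z hz
    have hle : S.T01 x ≤ LinearMap.ker (ext α) := by
      refine Submodule.span_le.2 ?_
      rintro _ ⟨v, rfl⟩
      exact (key v).2 (h v)
    exact hle hz

namespace ContactForm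

variable (θ : ContactForm S)

theorem form_reeb (x : M) : θ.form x ![θ.reeb x] = 1 := (θ.existsUnique_reeb x).choose_spec.1.1

theorem d_reeb (x : M) (v : TangentSpace (𝓡 3) x) : Form.d θ.form x ![θ.reeb x, v] = 0 :=
  (θ.existsUnique_reeb x).choose_spec.1.2 v

theorem toC_apply (x : M) (v : TangentSpace (𝓡 3) x) : θ.toC x ![v] = (θ.form x ![v] : ℂ) := rfl

theorem toC_reeb (x : M) : θ.toC x ![θ.reeb x] = 1 := by rw [toC_apply, form_reeb]; rfl

theorem toC_H {x : M} (v : S.H x) : θ.toC x ![(v : TangentSpace (𝓡 3) x)] = 0 := by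
  rw [toC_apply, (θ.ker x v).2 v.2]; rfl

theorem is10_toC (x : M) : S.Is10 x (θ.toC x) := by
  refine CRStructure.is10_iff.2 fun v => ?_
  rw [toC_H, toC_H, mul_zero]

theorem smoothAt_toC (x : M) : Form.SmoothAt θ.toC x := Form.SmoothAt.ofReal (θ.smooth x trivial)

theorem d_toC (x : M) : Form.d θ.toC x = θ.dC x := d_ofReal (θ.smooth x trivial)

theorem conj_toC (x : M) : conjForm (θ.toC x) = θ.toC x := conjForm_ofRealForm _

variable {θ} {U : Set M}

namespace AdmissibleCoframe

variable (e : θ.AdmissibleCoframe U)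

theorem bar_apply (x : M) (v : TangentSpace (𝓡 3) x) : e.bar x ![v] = conj (e.form x ![v]) := rfl

theorem exists_vector {x : M} (hx : x ∈ U) : ∃ v : S.H x, e.form x ![(v : TangentSpace (𝓡 3) x)] ≠ 0 := by
  by_contra hcon
  push Not at hcon
  obtain ⟨z, hz, hne⟩ := e.basis x hx
  have hle : S.T10 x ≤ LinearMap.ker (ext (e.form x)) := by
    refine Submodule.span_le.2 ?_
    rintro _ ⟨v, rfl⟩
    change ext (e.form x) _ = 0
    rw [map_sub, ext_tmul, ext_tmul, hcon, hcon]
    simp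
  exact hne (hle hz)

theorem form_J {x : M} (hx : x ∈ U) (v : S.H x) :
    e.form x ![(S.J x v : TangentSpace (𝓡 3) x)] =
      Complex.I * e.form x ![(v : TangentSpace (𝓡 3) x)] :=
  CRStructure.is10_iff.1 (e.is10 x hx) v

/-- The three-form `θ ∧ θ¹ ∧ θ^1̄`. -/
def vol : Form M ℂ 3 := fun x => wedge (θ.toC x) (wedge (e.form x) (e.bar x))

/-- This value yields both the independence of `θ, θ¹, θ^1̄` and the sign of the Levi form `h`. -/
theorem wedge_form_bar {x : M} (hx : x ∈ U) (v : S.H x) :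
    wedge (e.form x) (e.bar x) ![(v : TangentSpace (𝓡 3) x), (S.J x v : TangentSpace (𝓡 3) x)] =
      -2 * Complex.I * Complex.normSq (e.form x ![(v : TangentSpace (𝓡 3) x)]) := by
  rw [wedge_one_apply, bar_apply, bar_apply, form_J e hx, map_mul, Complex.conj_I,
    Complex.normSq_eq_conj_mul_self]
  ring

theorem vol_ne_zero {x : M} (hx : x ∈ U) : e.vol x ≠ 0 := by
  obtain ⟨v, hv⟩ := e.exists_vector hx
  intro h
  have h1 : e.vol x ![θ.reeb x, (v : TangentSpace (𝓡 3) x), (S.J x v : TangentSpace (𝓡 3) x)] = 0 := by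
    rw [h]; rfl
  rw [vol, wedge_two_apply, toC_reeb, toC_H, toC_H, wedge_form_bar e hx] at h1
  simp [hv] at h1

theorem smoothAt_form {x : M} (hx : x ∈ U) : Form.SmoothAt e.form x := e.smooth x hx

theorem smoothAt_bar {x : M} (hx : x ∈ U) : Form.SmoothAt e.bar x := (e.smoothAt_form hx).conj

theorem smoothAt_vol {x : M} (hx : x ∈ U) : Form.SmoothAt e.vol x :=
  (θ.smoothAt_toC x).wedge_two ((e.smoothAt_form hx).wedge_one (e.smoothAt_bar hx))

theorem d_bar {x : M} (hx : x ∈ U) : Form.d e.bar x = conjForm (Form.d e.form x) :=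
  d_conj (e.smoothAt_form hx)

theorem conj_form (x : M) : conjForm (e.form x) = e.bar x := rfl

theorem conj_bar (x : M) : conjForm (e.bar x) = e.form x := conjForm_conjForm _

theorem expand_one {x : M} (hx : x ∈ U) (β : TangentSpace (𝓡 3) x [⋀^Fin 1]→L[ℝ] ℂ) :
    ∃ c₀ c₁ c₂ : ℂ, β = c₀ • θ.toC x + c₁ • e.form x + c₂ • e.bar x :=
  form_one_expand (tangentBasis x) β (e.vol_ne_zero hx)

theorem expand_two {x : M} (hx : x ∈ U) (β : TangentSpace (𝓡 3) x [⋀^Fin 2]→L[ℝ] ℂ) :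
    ∃ c₀₁ c₀₂ c₁₂ : ℂ, β = c₀₁ • wedge (θ.toC x) (e.form x) + c₀₂ • wedge (θ.toC x) (e.bar x) +
      c₁₂ • wedge (e.form x) (e.bar x) :=
  form_two_expand (tangentBasis x) β (e.vol_ne_zero hx)

theorem eq_of_smul_vol {x : M} (hx : x ∈ U) {a b : ℂ} (h : a • e.vol x = b • e.vol x) : a = b := by
  obtain ⟨h0, -⟩ := form_three_eq_smul (tangentBasis x) 0 (e.vol_ne_zero hx)
  have := congrArg (fun γ => γ ![tangentBasis x 0, tangentBasis x 1, tangentBasis x 2]) h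
  simp only [ContinuousAlternatingMap.smul_apply, smul_eq_mul] at this
  exact mul_right_cancel₀ h0 this

end AdmissibleCoframe

end ContactForm

/-! Coefficients of forms, extracted by wedging with the coframe. -/

section Coefficients

variable {V : Type*} [AddCommGroup V] [Module ℝ V] [TopologicalSpace V]
variable (b : Module.Basis (Fin 3) ℝ V) (t a s : V [⋀^Fin 1]→L[ℝ] ℂ) (c₀ c₁ c₂ : ℂ)

include b

theorem wedge_coeff_one_zero : wedge (c₀ • t + c₁ • a + c₂ • s) (wedge a s) = c₀ • wedge t (wedge a s) := by
  refine form_three_ext b ?_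
  simp only [wedge_two_apply, wedge_one_apply, ContinuousAlternatingMap.add_apply,
    ContinuousAlternatingMap.smul_apply, smul_eq_mul]
  ring

theorem wedge_coeff_one_one : wedge t (wedge (c₀ • t + c₁ • a + c₂ • s) s) = c₁ • wedge t (wedge a s) := by
  refine form_three_ext b ?_
  simp only [wedge_two_apply, wedge_one_apply, ContinuousAlternatingMap.add_apply,
    ContinuousAlternatingMap.smul_apply, smul_eq_mul]
  ring

theorem wedge_coeff_one_two : wedge t (wedge a (c₀ • t + c₁ • a + c₂ • s)) = c₂ • wedge t (wedge a s) := by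
  refine form_three_ext b ?_
  simp only [wedge_two_apply, wedge_one_apply, ContinuousAlternatingMap.add_apply,
    ContinuousAlternatingMap.smul_apply, smul_eq_mul]
  ring

theorem wedge_coeff_two_zero :
    wedge s (c₀ • wedge t a + c₁ • wedge t s + c₂ • wedge a s) = c₀ • wedge t (wedge a s) := by
  refine form_three_ext b ?_
  simp only [wedge_two_apply, wedge_one_apply, ContinuousAlternatingMap.add_apply,
    ContinuousAlternatingMap.smul_apply, smul_eq_mul]
  ring

theorem wedge_coeff_two_one :
    wedge a (c₀ • wedge t a + c₁ • wedge t s + c₂ • wedge a s) = (-c₁) • wedge t (wedge a s) := by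
  refine form_three_ext b ?_
  simp only [wedge_two_apply, wedge_one_apply, ContinuousAlternatingMap.add_apply,
    ContinuousAlternatingMap.smul_apply, smul_eq_mul]
  ring

theorem wedge_coeff_two_two :
    wedge t (c₀ • wedge t a + c₁ • wedge t s + c₂ • wedge a s) = c₂ • wedge t (wedge a s) := by
  refine form_three_ext b ?_
  simp only [wedge_two_apply, wedge_one_apply, ContinuousAlternatingMap.add_apply,
    ContinuousAlternatingMap.smul_apply, smul_eq_mul]
  ring

end Coefficients

namespace ContactForm.AdmissibleCoframe

variable {θ : ContactForm S} {U : Set M} (e : θ.AdmissibleCoframe U)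

theorem coeff_one_unique {x : M} (hx : x ∈ U) {c₀ c₁ c₂ d₀ d₁ d₂ : ℂ}
    (h : c₀ • θ.toC x + c₁ • e.form x + c₂ • e.bar x =
      d₀ • θ.toC x + d₁ • e.form x + d₂ • e.bar x) : c₀ = d₀ ∧ c₁ = d₁ ∧ c₂ = d₂ := by
  refine ⟨e.eq_of_smul_vol hx ?_, e.eq_of_smul_vol hx ?_, e.eq_of_smul_vol hx ?_⟩
  · rw [vol, ← wedge_coeff_one_zero (tangentBasis x) _ _ _ c₀ c₁ c₂, h,
      wedge_coeff_one_zero (tangentBasis x)]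
  · rw [vol, ← wedge_coeff_one_one (tangentBasis x) _ _ _ c₀ c₁ c₂, h,
      wedge_coeff_one_one (tangentBasis x)]
  · rw [vol, ← wedge_coeff_one_two (tangentBasis x) _ _ _ c₀ c₁ c₂, h,
      wedge_coeff_one_two (tangentBasis x)]

theorem coeff_two_unique {x : M} (hx : x ∈ U) {c₀ c₁ c₂ d₀ d₁ d₂ : ℂ}
    (h : c₀ • wedge (θ.toC x) (e.form x) + c₁ • wedge (θ.toC x) (e.bar x) +
        c₂ • wedge (e.form x) (e.bar x) =
      d₀ • wedge (θ.toC x) (e.form x) + d₁ • wedge (θ.toC x) (e.bar x) +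
        d₂ • wedge (e.form x) (e.bar x)) : c₀ = d₀ ∧ c₁ = d₁ ∧ c₂ = d₂ := by
  refine ⟨e.eq_of_smul_vol hx ?_, neg_injective (e.eq_of_smul_vol hx ?_), e.eq_of_smul_vol hx ?_⟩
  · rw [vol, ← wedge_coeff_two_zero (tangentBasis x) _ _ _ c₀ c₁ c₂, h,
      wedge_coeff_two_zero (tangentBasis x)]
  · rw [vol, ← wedge_coeff_two_one (tangentBasis x) _ _ _ c₀ c₁ c₂, h,
      wedge_coeff_two_one (tangentBasis x)]
  · rw [vol, ← wedge_coeff_two_two (tangentBasis x) _ _ _ c₀ c₁ c₂, h,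
      wedge_coeff_two_two (tangentBasis x)]

end ContactForm.AdmissibleCoframe

end Coframes

/-! ### Curvature of the Tanaka-Webster connection and part (b) -/

section ConnectionIdentities

open Filter Topology

section Algebra

variable {V : Type*} [AddCommGroup V] [Module ℝ V] [TopologicalSpace V]

/-- The left side is `d(θ¹ ∧ ω + k θ ∧ θ^1̄)` in components: `wᵢ` for `ω`, `wᵢ'` for `ω̄`, `k =
h⁻¹Ā` with differential `kᵢ` and conjugate `k'`, `nᵢ` for the part of `dω` along `θ`, `ρ = Rh` and
`l = ih`. -/
theorem bianchi_algebra (b : Module.Basis (Fin 3) ℝ V) (t a s : V [⋀^Fin 1]→L[ℝ] ℂ)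
    (w₀ w₁ w₂ w₀' w₁' w₂' k k' k₀ k₁ k₂ n₀ n₁ n₂ ρ l : ℂ) :
    wedge (w₀ • t + w₁ • a + w₂ • s) (wedge a (w₀ • t + w₁ • a + w₂ • s) + wedge t (k • s)) +
        (-1 : ℂ) • wedge a (ρ • wedge a s + wedge t (n₀ • t + n₁ • a + n₂ • s)) +
      (wedge (k • s) (l • wedge a s) +
        (-1 : ℂ) • wedge t (wedge (k₀ • t + k₁ • a + k₂ • s) s +
          k • (wedge s (w₀' • t + w₁' • a + w₂' • s) + wedge t (k' • a)))) =
      (n₂ - k₁ - k * w₁ + k * w₁') • wedge t (wedge a s) := by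
  refine form_three_ext b ?_
  simp only [wedge_two_apply, wedge_one_apply, ContinuousAlternatingMap.add_apply,
    ContinuousAlternatingMap.smul_apply, smul_eq_mul]
  ring

/-- Applied to the sum of `dω` and its conjugate. The same `ρ` occurs twice because `Rh` is real, so
the `a ∧ s` terms cancel. -/
theorem metric_algebra (b : Module.Basis (Fin 3) ℝ V) (t a s : V [⋀^Fin 1]→L[ℝ] ℂ)
    (n₀ n₁ n₂ n₀' n₁' n₂' ρ : ℂ) :
    ρ • wedge a s + wedge t (n₀ • t + n₁ • a + n₂ • s) +
        (ρ • wedge s a + wedge t (n₀' • t + n₁' • a + n₂' • s)) =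
      (n₁ + n₁') • wedge t a + (n₂ + n₂') • wedge t s + (0 : ℂ) • wedge a s := by
  apply form_two_ext b <;>
  · simp only [wedge_one_apply, ContinuousAlternatingMap.add_apply,
      ContinuousAlternatingMap.smul_apply, smul_eq_mul]
    ring

/-- This is `dω + i dR ∧ θ + iR dθ`. The coefficient `i` of `Rθ` is the one that makes `Rh + iR ·
ih` vanish. -/
theorem curvature_algebra (b : Module.Basis (Fin 3) ℝ V) (t a s : V [⋀^Fin 1]→L[ℝ] ℂ)
    (n₀ n₁ n₂ r₀ r₁ r₂ R h : ℂ) :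
    (R * h) • wedge a s + wedge t (n₀ • t + n₁ • a + n₂ • s) +
        (wedge (Complex.I • (r₀ • t + r₁ • a + r₂ • s)) t +
          (Complex.I * R) • ((Complex.I * h) • wedge a s)) =
      (n₁ - Complex.I * r₁) • wedge t a + (n₂ - Complex.I * r₂) • wedge t s +
        (0 : ℂ) • wedge a s := by
  apply form_two_ext b <;>
  · simp only [wedge_one_apply, ContinuousAlternatingMap.add_apply,
      ContinuousAlternatingMap.smul_apply, smul_eq_mul]
    ring_nf
    rw [Complex.I_sq]
    ring

end Algebra

variable {M : Type*} [TopologicalSpace M] [ChartedSpace E3 M] [IsManifold (𝓡 3) ∞ M]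

/-- A connection form that is compatible with a Hermitian metric has imaginary curvature. -/
theorem conj_d_of_metric {U : Set M} (hU : IsOpen U) {h : M → ℂ} {γ : Form M ℂ 1}
    (hh : ∀ x ∈ U, FunSmoothAt h x) (h0 : ∀ x ∈ U, h x ≠ 0) (hγ : ∀ x ∈ U, Form.SmoothAt γ x)
    (hm : ∀ x ∈ U, h x • γ x + h x • conjForm (γ x) = dFun h x) {x : M} (hx : x ∈ U) :
    Form.d γ x + conjForm (Form.d γ x) = 0 := by
  have hσ : ∀ y ∈ U, Form.SmoothAt (fun z => γ z + conjForm (γ z)) y := fun y hy =>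
    (hγ y hy).add (hγ y hy).conj
  -- Put `σ = γ + γ̄`, so `hσ = dh` is closed. In `d(hσ) = dh ∧ σ + h dσ` the first term is `h σ ∧ σ
  -- = 0`, hence `dσ = 0`; no logarithm of `h` is needed.
  have h1 : Form.d (fun y => h y • (γ y + conjForm (γ y))) x = 0 := by
    rw [d_congr hU (γ := dFun h) (fun y hy => by rw [smul_add, hm y hy]) hx]
    exact d_dFun hU hh hx
  rw [d_smul (hh x hx) (hσ x hx), d_add (hγ x hx) (hγ x hx).conj, d_conj (hγ x hx),
    ← hm x hx, ← smul_add, wedge_smul_left] at h1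
  have h2 : wedge (γ x + conjForm (γ x)) (γ x + conjForm (γ x)) = 0 := by
    apply form_two_ext (tangentBasis x) <;>
    · rw [wedge_one_apply, mul_comm, sub_self]; rfl
  rw [h2, form_smul_zero, zero_add] at h1
  exact form_smul_eq_zero (h0 x hx) h1

variable {S : CRStructure M} {θ : ContactForm S} {U : Set M} {e : θ.AdmissibleCoframe U}

namespace ContactForm.TanakaWebster

variable (D : θ.TanakaWebster e)

theorem ext_Z {x : M} (hx : x ∈ U) (c₀ c₁ c₂ : ℂ) :
    ext (c₀ • θ.toC x + c₁ • e.form x + c₂ • e.bar x) (D.Z x) = c₁ := by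
  obtain ⟨h0, h1, h2⟩ := D.Z_dual x hx
  simp [ext_add, ext_smul, h0, h1, h2]

theorem ext_Zbar {x : M} (hx : x ∈ U) (c₀ c₁ c₂ : ℂ) :
    ext (c₀ • θ.toC x + c₁ • e.form x + c₂ • e.bar x) (D.Zbar x) = c₂ := by
  obtain ⟨h0, h1, h2⟩ := D.Zbar_dual x hx
  simp [ext_add, ext_smul, h0, h1, h2]

theorem h_ne_zero {x : M} (hx : x ∈ U) : (D.h x : ℂ) ≠ 0 :=
  Complex.ofReal_ne_zero.2 (D.h_pos x hx).ne'

theorem conj_expand (e : θ.AdmissibleCoframe U) {x : M} (c₀ c₁ c₂ : ℂ) :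
    conjForm (c₀ • θ.toC x + c₁ • e.form x + c₂ • e.bar x) =
      conj c₀ • θ.toC x + conj c₂ • e.form x + conj c₁ • e.bar x := by
  rw [conjForm_add, conjForm_add, conjForm_smul, conjForm_smul, conjForm_smul, θ.conj_toC,
    e.conj_form, e.conj_bar]
  abel

theorem conj_dFun_ofReal {f : M → ℝ} {x : M} (hf : FunSmoothAt (fun y => (f y : ℂ)) x) :
    conjForm (dFun (fun y => (f y : ℂ)) x) = dFun (fun y => (f y : ℂ)) x := by
  rw [← dFun_conj hf]
  simp

/-- The curvature of the Tanaka-Webster connection: the components of `dω_1^1` along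
`θ ∧ θ¹` and `θ ∧ θ^1̄` are given by the divergence of the torsion. -/
theorem d_conn (hU : IsOpen U) {x : M} (hx : x ∈ U) : ∃ n₀ : ℂ,
    Form.d D.conn x = ((D.R x : ℂ) * D.h x) • wedge (e.form x) (e.bar x) +
      wedge (θ.toC x) (n₀ • θ.toC x + (-D.divA x) • e.form x + conj (D.divA x) • e.bar x) := by
  have sh := (funSmoothOn_iff hU).1 D.h_smooth
  have sA := (funSmoothOn_iff hU).1 D.A_smooth
  have h0 := D.h_ne_zero hx
  set k : M → ℂ := fun y => (D.h y : ℂ)⁻¹ * conj (D.A y) with hk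
  have sk : ∀ y ∈ U, FunSmoothAt k y := fun y hy =>
    ((sh y hy).inv (D.h_ne_zero hy)).mul (sA y hy).conj
  have sa : ∀ y ∈ U, Form.SmoothAt e.form y := fun y hy => e.smoothAt_form hy
  have sb : ∀ y ∈ U, Form.SmoothAt e.bar y := fun y hy => e.smoothAt_bar hy
  have sw : ∀ y ∈ U, Form.SmoothAt D.conn y := D.conn_smooth
  obtain ⟨η, hη⟩ := D.curvature x hx
  obtain ⟨n₀, n₁, n₂, rfl⟩ := e.expand_one hx η
  obtain ⟨w₀, w₁, w₂, hw⟩ := e.expand_one hx (D.conn x)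
  obtain ⟨k₀, k₁, k₂, hdk⟩ := e.expand_one hx (dFun k x)
  obtain ⟨A₀, A₁, A₂, hdA⟩ := e.expand_one hx (dFun D.A x)
  obtain ⟨s₀, s₁, s₂, hdh⟩ := e.expand_one hx (dFun (fun y => (D.h y : ℂ)) x)
  have hdiv : D.divA x = (D.h x : ℂ)⁻¹ * (A₂ - 2 * w₂ * D.A x) := by
    rw [divA, hdA, hw, ext_Zbar D hx, ext_Zbar D hx]
  have hda := D.structure_eq x hx
  have hdb : Form.d e.bar x = wedge (e.bar x) (conj w₀ • θ.toC x + conj w₂ • e.form x + conj w₁ • e.bar x) +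
      wedge (θ.toC x) (conj (k x) • e.form x) := by
    rw [e.d_bar hx, hda, conjForm_add, conjForm_wedge, conjForm_wedge, hw, conj_expand,
      θ.conj_toC, conjForm_smul, e.conj_form, e.conj_bar]
  -- the first Bianchi identity
  have hdd : Form.d (Form.d e.form) x = 0 := d_d hU sa hx
  rw [d_congr hU (γ := fun y => wedge (e.form y) (D.conn y) + wedge (θ.toC y) (k y • e.bar y))
    D.structure_eq hx,
    d_add ((sa x hx).wedge_one (sw x hx))
      ((θ.smoothAt_toC x).wedge_one (Form.SmoothAt.smul (sk x hx) (sb x hx))),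
    d_wedge (sa x hx) (sw x hx),
    d_wedge (θ.smoothAt_toC x) (Form.SmoothAt.smul (sk x hx) (sb x hx)),
    d_smul (sk x hx) (sb x hx), θ.d_toC, D.levi x hx, hη, hda, hdb, hdk, hw] at hdd
  rw [bianchi_algebra (tangentBasis x)] at hdd
  have h1 : n₂ - k₁ - k x * w₁ + k x * conj w₂ = 0 :=
    (smul_eq_zero.1 hdd).resolve_right (e.vol_ne_zero hx)
  -- compatibility with the metric
  have hm := D.metric x hx
  rw [hw, conj_expand, hdh] at hm
  have h2 : (D.h x : ℂ) * (w₁ + conj w₂) = s₁ := by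
    refine (e.coeff_one_unique hx (c₀ := D.h x * (w₀ + conj w₀)) (c₂ := D.h x * (w₂ + conj w₁))
      (d₀ := s₀) (d₂ := s₂) ?_).2.1
    rw [← hm]; module
  have hdA' : dFun (fun y => conj (D.A y)) x = conj A₀ • θ.toC x + conj A₂ • e.form x + conj A₁ • e.bar x := by
    rw [dFun_conj (sA x hx), hdA, conj_expand]
  have h3 : k x * s₁ + D.h x * k₁ = conj A₂ := by
    have h4 := dFun_mul (sh x hx) (sk x hx)
    rw [dFun_congr hU (g := fun y => conj (D.A y)) (fun y hy => by
      rw [hk, mul_inv_cancel_left₀ (D.h_ne_zero hy)]) hx, hdA', hdh, hdk] at h4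
    refine ((e.coeff_one_unique hx (c₀ := conj A₀) (c₁ := conj A₂) (c₂ := conj A₁)
      (d₀ := k x * s₀ + D.h x * k₀) (d₁ := k x * s₁ + D.h x * k₁)
      (d₂ := k x * s₂ + D.h x * k₂) ?_).2.1).symm
    rw [h4]; module
  have hkx : (D.h x : ℂ) * k x = conj (D.A x) := by
    rw [hk]; exact mul_inv_cancel_left₀ h0 _
  -- Multiply `h1` by `h`. The product rule for `h k = Ā` (`h3`) replaces `h k₁` by `conj A₂ - k
  -- s₁`, and metric compatibility (`h2`) rewrites `s₁`. The `w₁` terms cancel and the two `conj w₂`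
  -- terms add up, leaving `h n₂ = conj (A₂ - 2 w₂ A)`.
  have hn2 : n₂ = conj (D.divA x) := by
    rw [hdiv]
    simp only [map_mul, map_inv₀, map_sub, Complex.conj_ofReal, map_ofNat]
    rw [eq_inv_mul_iff_mul_eq₀ h0]
    linear_combination (D.h x : ℂ) * h1 + h3 + k x * h2 - 2 * conj w₂ * hkx
  -- the curvature is imaginary
  have hc := conj_d_of_metric hU sh (fun y hy => D.h_ne_zero hy) sw D.metric hx
  rw [hη, conjForm_add, conjForm_smul, conjForm_wedge, conjForm_wedge, conj_expand, θ.conj_toC,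
    e.conj_form, e.conj_bar, map_mul, Complex.conj_ofReal, Complex.conj_ofReal,
    metric_algebra (tangentBasis x)] at hc
  have h5 : n₁ + conj n₂ = 0 := by
    refine (e.coeff_two_unique hx (d₀ := 0) (d₁ := 0) (d₂ := 0) (hc.trans ?_)).1
    simp only [form_zero_smul, add_zero]
  refine ⟨n₀, ?_⟩
  rw [hη, ← hn2, show n₁ = -D.divA x by
    rw [hn2, Complex.conj_conj] at h5; linear_combination h5]

/-- The exterior derivative of `ω_1^1 + i R θ`. -/
theorem d_curvForm (hU : IsOpen U) {x : M} (hx : x ∈ U) :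
    Form.d D.curvForm x =
      (-Complex.I * (D.gradR x - Complex.I * D.divA x)) • wedge (θ.toC x) (e.form x) +
      (-Complex.I * conj (D.gradR x - Complex.I * D.divA x)) • wedge (θ.toC x) (e.bar x) +
      (0 : ℂ) • wedge (e.form x) (e.bar x) := by
  have sR := (funSmoothOn_iff hU).1 D.R_smooth x hx
  obtain ⟨n₀, hn⟩ := D.d_conn hU hx
  obtain ⟨r₀, r₁, r₂, hr⟩ := e.expand_one hx (dFun (fun y => (D.R y : ℂ)) x)
  have hr2 : r₂ = conj r₁ := by
    have := conj_dFun_ofReal sR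
    rw [hr, conj_expand] at this
    exact (e.coeff_one_unique hx this).2.2.symm
  have hg : D.gradR x = r₁ := by rw [gradR, hr, ext_Z D hx]
  have sIR : FunSmoothAt (fun y => Complex.I * (D.R y : ℂ)) x := (funSmoothAt_const _ x).mul sR
  have e1 : Form.d D.curvForm x = Form.d D.conn x +
      Form.d (fun y => (Complex.I * (D.R y : ℂ)) • θ.toC y) x :=
    d_add (D.conn_smooth x hx) (Form.SmoothAt.smul sIR (θ.smoothAt_toC x))
  rw [e1, d_smul sIR (θ.smoothAt_toC x), dFun_mul (funSmoothAt_const _ x) sR, dFun_const,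
    smul_zero, zero_add, θ.d_toC, D.levi x hx, hn, hr, curvature_algebra (tangentBasis x), hg, hr2]
  congr 3
  · linear_combination (-D.divA x) * Complex.I_mul_I
  · simp only [map_sub, map_mul, Complex.conj_I]
    linear_combination conj (D.divA x) * Complex.I_mul_I

theorem d_curvForm_eq_zero_iff (hU : IsOpen U) {x : M} (hx : x ∈ U) :
    Form.d D.curvForm x = 0 ↔ D.gradR x - Complex.I * D.divA x = 0 := by
  rw [D.d_curvForm hU hx]
  constructor
  · intro h
    have := (e.coeff_two_unique hx (d₀ := 0) (d₁ := 0) (d₂ := 0) (h.trans (by simp only [form_zero_smul, add_zero]))).1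
    simpa using this
  · intro h
    rw [h]
    simp only [map_zero, mul_zero, form_zero_smul, add_zero]

end ContactForm.TanakaWebster

/-- Both conditions quantify over the same coframes and data, so the pointwise equivalence suffices.
-/
theorem ContactForm.pseudoEinstein_iff (θ : ContactForm S) : θ.PseudoEinstein ↔
    ∀ U : Set M, IsOpen U → ∀ (e : θ.AdmissibleCoframe U) (D : θ.TanakaWebster e),
      ∀ x ∈ U, Form.d D.curvForm x = 0 :=
  forall₂_congr fun _ hU => forall₂_congr fun _ D => forall₂_congr fun _ hx =>
    (D.d_curvForm_eq_zero_iff hU hx).symm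

end ConnectionIdentities

/-! ### Sections of the canonical bundle; closed normalized sections imply pseudo-Einstein -/

section CanonicalSections

open Filter Topology

variable {M : Type*} [TopologicalSpace M] [ChartedSpace E3 M] [IsManifold (𝓡 3) ∞ M]
variable {S : CRStructure M} {θ : ContactForm S} {U : Set M}

/-- Differentiating `u · u⁻¹ = 1` shows that `d(u⁻¹)` is proportional to `du`, so `d(u⁻¹) ∧ du = 0`.
This avoids choosing a branch of `log u`. -/
theorem d_inv_smul_dFun {W : Set M} (hW : IsOpen W) {u : M → ℂ} (hu : ∀ x ∈ W, FunSmoothAt u x)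
    (h0 : ∀ x ∈ W, u x ≠ 0) {x : M} (hx : x ∈ W) :
    Form.d (fun y => (u y)⁻¹ • dFun u y) x = 0 := by
  have hi := (hu x hx).inv (h0 x hx)
  rw [d_smul hi (SmoothAt.dFun hW hu hx), d_dFun hW hu hx, form_smul_zero, add_zero]
  have h1 := dFun_mul (hu x hx) hi
  rw [dFun_congr hW (g := fun _ => 1) (fun y hy => mul_inv_cancel₀ (h0 y hy)) hx, dFun_const] at h1
  apply form_two_ext (tangentBasis x) <;>
  · refine mul_left_cancel₀ (h0 x hx) ?_
    have e : ∀ v, u x * dFun (fun y => (u y)⁻¹) x ![v] = -(u x)⁻¹ * dFun u x ![v] := by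
      intro v
      have := congrArg (fun γ => γ ![v]) h1
      simp only [ContinuousAlternatingMap.add_apply, ContinuousAlternatingMap.smul_apply,
        smul_eq_mul] at this
      change 0 = _ at this
      linear_combination -this
    rw [wedge_one_apply, mul_sub, ← mul_assoc, ← mul_assoc, e, e]
    change _ = u x * 0
    ring

namespace ContactForm.AdmissibleCoframe

variable (e : θ.AdmissibleCoframe U)

theorem wedge_ne_zero {x : M} (hx : x ∈ U) : wedge (θ.toC x) (e.form x) ≠ 0 := by
  intro h
  have h1 := (e.coeff_two_unique hx (c₀ := 1) (c₁ := 0) (c₂ := 0) (d₀ := 0) (d₁ := 0) (d₂ := 0)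
    (by simp only [form_zero_smul, add_zero, one_smul]; exact h)).1
  exact one_ne_zero h1

/-- On `H`, composition with `J` multiplies `α` and `θ¹` by `i` but `θ^1̄` by `-i`, so the `θ^1̄`
component must vanish. -/
theorem expand_is10 {x : M} (hx : x ∈ U) {α : TangentSpace (𝓡 3) x [⋀^Fin 1]→L[ℝ] ℂ}
    (h : S.Is10 x α) : ∃ c₀ c₁ : ℂ, α = c₀ • θ.toC x + c₁ • e.form x := by
  obtain ⟨c₀, c₁, c₂, rfl⟩ := e.expand_one hx α
  obtain ⟨v, hv⟩ := e.exists_vector hx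
  have h1 := CRStructure.is10_iff.1 h v
  simp only [ContinuousAlternatingMap.add_apply, ContinuousAlternatingMap.smul_apply, smul_eq_mul,
    θ.toC_H, bar_apply, e.form_J hx, map_mul, Complex.conj_I] at h1
  have h2 : (2 * Complex.I * conj (e.form x ![(v : TangentSpace (𝓡 3) x)])) * c₂ = 0 := by
    linear_combination -h1
  have h3 : c₂ = 0 := by
    refine (mul_eq_zero.1 h2).resolve_left ?_
    simp [hv]
  exact ⟨c₀, c₁, by rw [h3, form_zero_smul, add_zero]⟩

/-- `Λ^{1,0}` is spanned by `θ` and `θ¹`, so its second exterior power is a line. The factor `u` is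
attached to `θ` so that the Leibniz rule for two one-forms applies to `ξ`. -/
theorem mem_K_iff {x : M} (hx : x ∈ U) {ξ : TangentSpace (𝓡 3) x [⋀^Fin 2]→L[ℝ] ℂ} :
    ξ ∈ S.K x ↔ ∃ u : ℂ, ξ = wedge (u • θ.toC x) (e.form x) := by
  constructor
  · intro h
    have hle : S.K x ≤ Submodule.span ℂ {wedge (θ.toC x) (e.form x)} := by
      refine Submodule.span_le.2 ?_
      rintro _ ⟨α, β, hα, hβ, rfl⟩
      obtain ⟨c₀, c₁, rfl⟩ := e.expand_is10 hx hα
      obtain ⟨d₀, d₁, rfl⟩ := e.expand_is10 hx hβ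
      refine Submodule.mem_span_singleton.2 ⟨c₀ * d₁ - c₁ * d₀, ?_⟩
      apply form_two_ext (tangentBasis x) <;>
      · simp only [wedge_one_apply, ContinuousAlternatingMap.add_apply,
          ContinuousAlternatingMap.smul_apply, smul_eq_mul]
        ring
    obtain ⟨u, hu⟩ := Submodule.mem_span_singleton.1 (hle h)
    exact ⟨u, by rw [wedge_smul_left, hu]⟩
  · rintro ⟨u, rfl⟩
    rw [wedge_smul_left]
    exact Submodule.smul_mem _ _ (Submodule.subset_span
      ⟨_, _, θ.is10_toC x, e.is10 x hx, rfl⟩)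

theorem contract_reeb {x : M} (hx : x ∈ U) (u : ℂ) :
    contract (θ.reeb x) (wedge (u • θ.toC x) (e.form x)) = u • e.form x := by
  rw [wedge_smul_left, contract_smul, contract_wedge_one, θ.toC_reeb, e.reeb x hx]
  ext v
  simp

/-- Volume normalization in terms of the component of a section of the canonical bundle. -/
theorem volume_iff {x : M} (hx : x ∈ U) {h : ℝ}
    (hl : θ.dC x = (Complex.I * h) • wedge (e.form x) (e.bar x)) (u : ℂ) :
    wedge (θ.toC x) (θ.dC x) = Complex.I • wedge (θ.toC x)
      (wedge (contract (θ.reeb x) (wedge (u • θ.toC x) (e.form x)))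
        (contract (θ.reeb x) (conjForm (wedge (u • θ.toC x) (e.form x))))) ↔
    (h : ℂ) = u * conj u := by
  have e1 : wedge (θ.toC x) (θ.dC x) = (Complex.I * h) • e.vol x := by
    rw [hl, wedge_smul_right, vol]
  have e2 : Complex.I • wedge (θ.toC x)
      (wedge (contract (θ.reeb x) (wedge (u • θ.toC x) (e.form x)))
        (contract (θ.reeb x) (conjForm (wedge (u • θ.toC x) (e.form x))))) =
      (Complex.I * (u * conj u)) • e.vol x := by
    rw [contract_conjForm, e.contract_reeb hx, conjForm_smul, e.conj_form, wedge_smul_left,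
      wedge_smul_right, wedge_smul_right, wedge_smul_right, vol, smul_smul, smul_smul, mul_assoc]
  rw [e1, e2]
  constructor
  · intro h
    exact mul_left_cancel₀ Complex.I_ne_zero (e.eq_of_smul_vol hx h)
  · intro h
    rw [h]

end ContactForm.AdmissibleCoframe

theorem section_algebra {V : Type*} [AddCommGroup V] [Module ℝ V] [TopologicalSpace V]
    (b : Module.Basis (Fin 3) ℝ V) (t a s τ : V [⋀^Fin 1]→L[ℝ] ℂ) (u u₀ u₁ u₂ w₀ w₁ w₂ l : ℂ) :
    wedge a (wedge (u₀ • t + u₁ • a + u₂ • s) t + u • (l • wedge a s)) +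
        (-1 : ℂ) • wedge (u • t) (wedge a (w₀ • t + w₁ • a + w₂ • s) + wedge t τ) =
      (u₂ - u * w₂) • wedge t (wedge a s) := by
  refine form_three_ext b ?_
  simp only [wedge_two_apply, wedge_one_apply, ContinuousAlternatingMap.add_apply,
    ContinuousAlternatingMap.smul_apply, smul_eq_mul]
  ring

namespace ContactForm.TanakaWebster

variable {e : θ.AdmissibleCoframe U} (D : θ.TanakaWebster e)

/-- Torsion, `dθ` and all other components of `du` and `ω` drop out because they repeat a factor `θ`
or `θ¹`; closedness becomes one scalar equation. -/
theorem d_section {x : M} (hx : x ∈ U) {u : M → ℂ} (hu : FunSmoothAt u x)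
    {u₀ u₁ u₂ w₀ w₁ w₂ : ℂ}
    (hdu : dFun u x = u₀ • θ.toC x + u₁ • e.form x + u₂ • e.bar x)
    (hw : D.conn x = w₀ • θ.toC x + w₁ • e.form x + w₂ • e.bar x) :
    Form.d (fun y => wedge (u y • θ.toC y) (e.form y)) x = (u₂ - u x * w₂) • e.vol x := by
  rw [d_wedge (Form.SmoothAt.smul hu (θ.smoothAt_toC x)) (e.smoothAt_form hx),
    d_smul hu (θ.smoothAt_toC x), θ.d_toC, D.levi x hx, D.structure_eq x hx, hdu, hw,
    section_algebra (tangentBasis x), AdmissibleCoframe.vol]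

/-- If `ξ = u θ ∧ θ¹` is closed and `θ` is volume-normalized with respect to `ξ`, then
`ω_1^1 + i R θ` is the logarithmic differential of `u`. -/
theorem d_curvForm_of_closed (hU : IsOpen U) {W : Set M} (hW : IsOpen W) (hWU : W ⊆ U) {u : M → ℂ}
    (hu : ∀ x ∈ W, FunSmoothAt u x) (h0 : ∀ x ∈ W, u x ≠ 0)
    (hh : ∀ x ∈ W, (D.h x : ℂ) = u x * conj (u x))
    (hd : ∀ x ∈ W, Form.d (fun y => wedge (u y • θ.toC y) (e.form y)) x = 0) {x : M} (hx : x ∈ W) :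
    Form.d D.curvForm x = 0 := by
  -- Closedness of the section gives the `θ^1̄` component of `du = uω`. Inserting `h = u ū` into
  -- metric compatibility and cancelling the conjugate of that equation gives the `θ¹` component.
  have key : ∀ y ∈ W, ∃ c : ℂ, D.curvForm y + (-1 : ℂ) • ((u y)⁻¹ • dFun u y) = c • θ.toC y := by
    intro y hy
    have hyU := hWU hy
    obtain ⟨w₀, w₁, w₂, hw⟩ := e.expand_one hyU (D.conn y)
    obtain ⟨u₀, u₁, u₂, hdu⟩ := e.expand_one hyU (dFun u y)
    have h2 : u₂ - u y * w₂ = 0 := by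
      have := hd y hy
      rw [D.d_section hyU (hu y hy) hdu hw] at this
      exact e.eq_of_smul_vol hyU (this.trans (form_zero_smul _).symm)
    have hm := D.metric y hyU
    rw [dFun_congr hW (g := fun z => u z * conj (u z)) hh hy, dFun_mul (hu y hy) (hu y hy).conj,
      dFun_conj (hu y hy), hw, hdu, conj_expand, conj_expand, hh y hy] at hm
    have h1 : u y * conj (u y) * (w₁ + conj w₂) = conj (u y) * u₁ + u y * conj u₂ := by
      refine (e.coeff_one_unique hyU
        (c₀ := u y * conj (u y) * (w₀ + conj w₀)) (d₀ := conj (u y) * u₀ + u y * conj u₀)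
        (c₂ := u y * conj (u y) * (w₂ + conj w₁)) (d₂ := conj (u y) * u₂ + u y * conj u₁) ?_).2.1
      calc _ = _ := by module
        _ = _ := hm
        _ = _ := by module
    have h1' : u₁ = u y * w₁ := by
      have hne : conj (u y) ≠ 0 := by simpa using h0 y hy
      refine mul_left_cancel₀ hne ?_
      have h2' := congrArg conj h2
      simp only [map_sub, map_mul, map_zero] at h2'
      linear_combination -h1 - u y * h2'
    refine ⟨w₀ + Complex.I * D.R y - (u y)⁻¹ * u₀, ?_⟩
    have e1 : w₁ = (u y)⁻¹ * u₁ := by rw [h1', inv_mul_cancel_left₀ (h0 y hy)]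
    have e2 : w₂ = (u y)⁻¹ * u₂ := by rw [sub_eq_zero.1 h2, inv_mul_cancel_left₀ (h0 y hy)]
    rw [curvForm, hw, hdu, e1, e2]
    module
  choose! f hf using key
  have sR := (funSmoothOn_iff hU).1 D.R_smooth
  have sc : ∀ y ∈ W, Form.SmoothAt D.curvForm y := fun y hy =>
    (D.conn_smooth y (hWU hy)).add (Form.SmoothAt.smul ((funSmoothAt_const _ y).mul (sR y (hWU hy)))
      (θ.smoothAt_toC y))
  have sl : ∀ y ∈ W, Form.SmoothAt (fun z => (u z)⁻¹ • dFun u z) y := fun y hy =>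
    Form.SmoothAt.smul ((hu y hy).inv (h0 y hy)) (SmoothAt.dFun hW hu hy)
  have sf : ∀ y ∈ W, FunSmoothAt f y := by
    intro y hy
    refine FunSmoothAt.of_forms hW hf hy ((sc y hy).add
      (Form.SmoothAt.smul (funSmoothAt_const _ y) (sl y hy))) (θ.smoothAt_toC y) fun h => ?_
    have := θ.toC_reeb y
    rw [h] at this
    exact zero_ne_one this
  have hcf : ∀ y ∈ W, D.curvForm y = (u y)⁻¹ • dFun u y + f y • θ.toC y := by
    intro y hy
    rw [← hf y hy]
    module
  -- Since `du/u` is closed, `d(ω + iRθ) = df ∧ θ + f dθ`. Its `θ¹ ∧ θ^1̄` coefficient is `i f h`,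
  -- while `d_curvForm` says that coefficient is zero.
  have hf0 : ∀ y ∈ W, f y = 0 := by
    intro y hy
    have h1 := D.d_curvForm hU (hWU hy)
    rw [d_congr hW hcf hy, d_add (sl y hy) (Form.SmoothAt.smul (sf y hy) (θ.smoothAt_toC y)),
      d_inv_smul_dFun hW hu h0 hy, zero_add, d_smul (sf y hy) (θ.smoothAt_toC y), θ.d_toC,
      D.levi y (hWU hy)] at h1
    obtain ⟨c₀, c₁, c₂, hdf⟩ := e.expand_one (hWU hy) (dFun f y)
    have h2 : f y * (Complex.I * D.h y) = 0 := by
      refine (e.coeff_two_unique (hWU hy) (c₀ := -c₁) (c₁ := -c₂) (Eq.trans ?_ h1)).2.2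
      rw [hdf]
      apply form_two_ext (tangentBasis y) <;>
      · simp only [wedge_one_apply, ContinuousAlternatingMap.add_apply,
          ContinuousAlternatingMap.smul_apply, smul_eq_mul]
        ring
    exact (mul_eq_zero.1 h2).resolve_right
      (mul_ne_zero Complex.I_ne_zero (D.h_ne_zero (hWU hy)))
  rw [d_congr hW (γ := fun y => (u y)⁻¹ • dFun u y) (fun y hy => by
    rw [hcf y hy, hf0 y hy, form_zero_smul, add_zero]) hx]
  exact d_inv_smul_dFun hW hu h0 hx

end ContactForm.TanakaWebster

/-- The coframe is arbitrary and the section is given near each point, so the argument runs on the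
overlap of their domains, where `u` is smooth as a ratio of smooth forms. -/
theorem ContactForm.pseudoEinstein_of_sections (θ : ContactForm S)
    (H : ∀ p : M, ∃ U : Set M, IsOpen U ∧ p ∈ U ∧
        ∃ ξ : Form M ℂ 2, S.IsCanonicalSection U ξ ∧ (∀ x ∈ U, ξ x ≠ 0) ∧
          (∀ x ∈ U, Form.d ξ x = 0) ∧ θ.VolumeNormalizedOn U ξ) : θ.PseudoEinstein := by
  intro U hU e D x hx
  rw [← D.d_curvForm_eq_zero_iff hU hx]
  obtain ⟨U', hU', hxU', ξ, ⟨hξs, hξK⟩, hξ0, hξd, hξv⟩ := H x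
  have hW := hU.inter hU'
  have key : ∀ y ∈ U ∩ U', ∃ u : ℂ, ξ y = wedge (u • θ.toC y) (e.form y) := fun y hy =>
    (e.mem_K_iff hy.1).1 (hξK y hy.2)
  choose! u hu using key
  have su : ∀ y ∈ U ∩ U', FunSmoothAt u y := fun y hy =>
    FunSmoothAt.of_forms (Φ := fun z => wedge (θ.toC z) (e.form z)) hW
      (fun z hz => by rw [hu z hz, wedge_smul_left]) hy (hξs y hy.2)
      ((θ.smoothAt_toC y).wedge_one (e.smoothAt_form hy.1)) (e.wedge_ne_zero hy.1)
  refine D.d_curvForm_of_closed hU hW inter_subset_left su (fun y hy h => ?_) (fun y hy => ?_)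
    (fun y hy => ?_) ⟨hx, hxU'⟩
  · apply hξ0 y hy.2
    rw [hu y hy, h, form_zero_smul]
    ext v
    simp [wedge_apply]
  · have := hξv y hy.2
    rw [hu y hy] at this
    exact (e.volume_iff hy.1 (D.levi y hy.1) (u y)).1 this
  · rw [← d_congr hW hu hy]
    exact hξd y hy.2

end CanonicalSections

/-! ### Existence of the Tanaka-Webster connection -/

section TanakaWebsterExistence

open Filter Topology

/-- Computes `d(l θ¹ ∧ θ^1̄)` for `l = ih`, where `i sⱼ` are the components of `dl`, `p, q, r` those
of `dθ¹`, and primes denote conjugates. -/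
theorem levi_algebra {V : Type*} [AddCommGroup V] [Module ℝ V] [TopologicalSpace V]
    (b : Module.Basis (Fin 3) ℝ V) (t a s : V [⋀^Fin 1]→L[ℝ] ℂ)
    (i l s₀ s₁ s₂ p q r p' q' r' : ℂ) :
    wedge s (wedge (i • (s₀ • t + s₁ • a + s₂ • s)) a +
        l • (p • wedge t a + q • wedge t s + r • wedge a s)) +
      (-1 : ℂ) • wedge (l • a) (p' • wedge t s + q' • wedge t a + r' • wedge s a) =
      (i * s₀ + l * (p + p')) • wedge t (wedge a s) := by
  refine form_three_ext b ?_
  simp only [wedge_two_apply, wedge_one_apply, ContinuousAlternatingMap.add_apply,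
    ContinuousAlternatingMap.smul_apply, smul_eq_mul]
  ring

/-- The connection and torsion are read off from `dθ¹`. The `θ¹` component `w` stays free because
`θ¹ ∧ θ¹ = 0`; metric compatibility will fix it. -/
theorem structure_algebra {V : Type*} [AddCommGroup V] [Module ℝ V] [TopologicalSpace V]
    (b : Module.Basis (Fin 3) ℝ V) (t a s : V [⋀^Fin 1]→L[ℝ] ℂ) (p q r w : ℂ) :
    p • wedge t a + q • wedge t s + r • wedge a s =
      wedge a ((-p) • t + w • a + r • s) + wedge t (q • s) := by
  apply form_two_ext b <;>
  · simp only [wedge_one_apply, ContinuousAlternatingMap.add_apply,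
      ContinuousAlternatingMap.smul_apply, smul_eq_mul]
    ring

theorem imaginary_algebra {V : Type*} [AddCommGroup V] [Module ℝ V] [TopologicalSpace V]
    (b : Module.Basis (Fin 3) ℝ V) (t a s : V [⋀^Fin 1]→L[ℝ] ℂ) (p q r p' q' r' : ℂ) :
    p • wedge t a + q • wedge t s + r • wedge a s +
      (p' • wedge t s + q' • wedge t a + r' • wedge s a) =
      (p + q') • wedge t a + (q + p') • wedge t s + (r - r') • wedge a s := by
  apply form_two_ext b <;>
  · simp only [wedge_one_apply, ContinuousAlternatingMap.add_apply,
      ContinuousAlternatingMap.smul_apply, smul_eq_mul]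
    ring

variable {M : Type*} [TopologicalSpace M] [ChartedSpace E3 M] [IsManifold (𝓡 3) ∞ M]
variable {S : CRStructure M} {θ : ContactForm S} {U : Set M}

theorem ContactForm.smoothAt_dC (θ : ContactForm S) (x : M) : Form.SmoothAt θ.dC x := by
  have e : θ.dC = Form.d θ.toC := funext fun y => (θ.d_toC y).symm
  rw [e]
  exact Form.SmoothAt.d isOpen_univ (fun y _ => θ.smoothAt_toC y) (mem_univ x)

namespace ContactForm.AdmissibleCoframe

variable (e : θ.AdmissibleCoframe U)

theorem smooth_coeff_one (hU : IsOpen U) {β : Form M ℂ 1} (hβ : ∀ x ∈ U, Form.SmoothAt β x)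
    {c₀ c₁ c₂ : M → ℂ}
    (h : ∀ x ∈ U, β x = c₀ x • θ.toC x + c₁ x • e.form x + c₂ x • e.bar x) {x : M} (hx : x ∈ U) :
    FunSmoothAt c₀ x ∧ FunSmoothAt c₁ x ∧ FunSmoothAt c₂ x := by
  have st := θ.smoothAt_toC x
  have sa := e.smoothAt_form hx
  have sb := e.smoothAt_bar hx
  have sv := e.smoothAt_vol hx
  have h0 := e.vol_ne_zero hx
  refine ⟨FunSmoothAt.of_forms (Ψ := fun y => wedge (β y) (wedge (e.form y) (e.bar y))) hU ?_ hx
      ((hβ x hx).wedge_two (sa.wedge_one sb)) sv h0,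
    FunSmoothAt.of_forms (Ψ := fun y => wedge (θ.toC y) (wedge (β y) (e.bar y))) hU ?_ hx
      (st.wedge_two ((hβ x hx).wedge_one sb)) sv h0,
    FunSmoothAt.of_forms (Ψ := fun y => wedge (θ.toC y) (wedge (e.form y) (β y))) hU ?_ hx
      (st.wedge_two (sa.wedge_one (hβ x hx))) sv h0⟩
  · intro y hy
    rw [h y hy]
    exact wedge_coeff_one_zero (tangentBasis y) _ _ _ _ _ _
  · intro y hy
    rw [h y hy]
    exact wedge_coeff_one_one (tangentBasis y) _ _ _ _ _ _
  · intro y hy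
    rw [h y hy]
    exact wedge_coeff_one_two (tangentBasis y) _ _ _ _ _ _

theorem smooth_coeff_two (hU : IsOpen U) {β : Form M ℂ 2} (hβ : ∀ x ∈ U, Form.SmoothAt β x)
    {c₀ c₁ c₂ : M → ℂ}
    (h : ∀ x ∈ U, β x = c₀ x • wedge (θ.toC x) (e.form x) + c₁ x • wedge (θ.toC x) (e.bar x) +
      c₂ x • wedge (e.form x) (e.bar x)) {x : M} (hx : x ∈ U) :
    FunSmoothAt c₀ x ∧ FunSmoothAt c₁ x ∧ FunSmoothAt c₂ x := by
  have sv := e.smoothAt_vol hx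
  have h0 := e.vol_ne_zero hx
  have h1 : FunSmoothAt (fun y => -c₁ y) x := by
    refine FunSmoothAt.of_forms (Ψ := fun y => wedge (e.form y) (β y)) hU ?_ hx
      ((e.smoothAt_form hx).wedge_two (hβ x hx)) sv h0
    intro y hy
    rw [h y hy]
    exact wedge_coeff_two_one (tangentBasis y) _ _ _ _ _ _
  refine ⟨FunSmoothAt.of_forms (Ψ := fun y => wedge (e.bar y) (β y)) hU ?_ hx
      ((e.smoothAt_bar hx).wedge_two (hβ x hx)) sv h0, ?_,
    FunSmoothAt.of_forms (Ψ := fun y => wedge (θ.toC y) (β y)) hU ?_ hx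
      ((θ.smoothAt_toC x).wedge_two (hβ x hx)) sv h0⟩
  · intro y hy
    rw [h y hy]
    exact wedge_coeff_two_zero (tangentBasis y) _ _ _ _ _ _
  · simpa using h1.neg
  · intro y hy
    rw [h y hy]
    exact wedge_coeff_two_two (tangentBasis y) _ _ _ _ _ _

/-- Contracting with `T` and testing on `v` and `Jv` removes the components of `dθ` containing `θ`.
The last one is `i dθ(v, Jv) / (2 |θ¹(v)|²)`, so positivity of `dθ(·, J·)` gives `h > 0`. -/
theorem exists_levi {x : M} (hx : x ∈ U) :
    ∃ h : ℝ, 0 < h ∧ θ.dC x = (Complex.I * h) • wedge (e.form x) (e.bar x) := by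
  obtain ⟨c₀, c₁, c₂, hc⟩ := e.expand_two hx (θ.dC x)
  obtain ⟨v, hv⟩ := e.exists_vector hx
  set n := e.form x ![(v : TangentSpace (𝓡 3) x)] with hn
  have hr : ∀ w, θ.dC x ![θ.reeb x, w] = 0 := fun w => by
    change ((Form.d θ.form x ![θ.reeb x, w] : ℝ) : ℂ) = 0
    rw [θ.d_reeb]; rfl
  have hbr : e.bar x ![θ.reeb x] = 0 := by rw [bar_apply, e.reeb x hx, map_zero]
  have h1 := hr v
  have h2 := hr (S.J x v)
  rw [hc] at h1 h2
  simp only [ContinuousAlternatingMap.add_apply, ContinuousAlternatingMap.smul_apply, smul_eq_mul,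
    wedge_one_apply, θ.toC_reeb, θ.toC_H, e.reeb x hx, hbr, bar_apply, e.form_J hx, map_mul,
    Complex.conj_I, ← hn] at h1 h2
  have hcn : conj n ≠ 0 := by simpa using hv
  have h3 : c₀ = 0 := by
    have : (2 * n) * c₀ = 0 := by
      linear_combination h1 - Complex.I * h2 + (c₀ * n - c₁ * conj n) * Complex.I_mul_I
    exact (mul_eq_zero.1 this).resolve_left (mul_ne_zero two_ne_zero hv)
  have h4 : c₁ = 0 := by
    have : (conj n) * c₁ = 0 := by
      rw [h3] at h1
      linear_combination h1
    exact (mul_eq_zero.1 this).resolve_left hcn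
  rw [h3, h4, form_zero_smul, form_zero_smul, zero_add, zero_add] at hc
  have hv0 : v ≠ 0 := by
    rintro rfl
    apply hv
    rw [hn]
    exact (e.form x).map_coord_zero 0 rfl
  have hpos := θ.pos x v hv0
  have h5 : ((Form.d θ.form x ![(v : TangentSpace (𝓡 3) x), (S.J x v : TangentSpace (𝓡 3) x)] : ℝ) : ℂ) =
      c₂ * (-2 * Complex.I * Complex.normSq n) := by
    rw [← e.wedge_form_bar hx v]
    exact congrArg (fun γ => γ ![(v : TangentSpace (𝓡 3) x), (S.J x v : TangentSpace (𝓡 3) x)]) hc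
  have hn2 : 0 < Complex.normSq n := Complex.normSq_pos.2 hv
  refine ⟨_ / (2 * Complex.normSq n), div_pos hpos (by positivity), ?_⟩
  rw [hc]
  congr 1
  rw [Complex.ofReal_div, h5]
  have : (Complex.normSq n : ℂ) ≠ 0 := Complex.ofReal_ne_zero.2 hn2.ne'
  push_cast
  field_simp
  linear_combination c₂ * Complex.I_mul_I

theorem exists_frame {x : M} (hx : x ∈ U) : ∃ Z Zbar : ℂ ⊗[ℝ] TangentSpace (𝓡 3) x,
    (ext (θ.toC x) Z = 0 ∧ ext (e.form x) Z = 1 ∧ ext (e.bar x) Z = 0) ∧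
    (ext (θ.toC x) Zbar = 0 ∧ ext (e.form x) Zbar = 0 ∧ ext (e.bar x) Zbar = 1) := by
  obtain ⟨v, hv⟩ := e.exists_vector hx
  set n := e.form x ![(v : TangentSpace (𝓡 3) x)] with hn
  have hcn : conj n ≠ 0 := by simpa using hv
  refine ⟨(2 * n)⁻¹ • ((1 : ℂ) ⊗ₜ[ℝ] (v : TangentSpace (𝓡 3) x) -
      Complex.I ⊗ₜ[ℝ] (S.J x v : TangentSpace (𝓡 3) x)),
    (2 * conj n)⁻¹ • ((1 : ℂ) ⊗ₜ[ℝ] (v : TangentSpace (𝓡 3) x) +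
      Complex.I ⊗ₜ[ℝ] (S.J x v : TangentSpace (𝓡 3) x)), ⟨?_, ?_, ?_⟩, ⟨?_, ?_, ?_⟩⟩ <;>
  simp only [map_smul, map_sub, map_add, ext_tmul, θ.toC_H, bar_apply, e.form_J hx, map_mul,
    Complex.conj_I, ← hn, smul_eq_mul]
  · ring
  · field_simp
    linear_combination -Complex.I_mul_I
  · linear_combination ((2 * n)⁻¹ * conj n) * Complex.I_mul_I
  · ring
  · linear_combination ((2 * conj n)⁻¹ * n) * Complex.I_mul_I
  · field_simp
    linear_combination -Complex.I_mul_I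

/-- Every admissible coframe has a Tanaka-Webster connection. -/
theorem exists_tanakaWebster (hU : IsOpen U) : Nonempty (θ.TanakaWebster e) := by
  have sa : ∀ y ∈ U, Form.SmoothAt e.form y := fun y hy => e.smoothAt_form hy
  have sb : ∀ y ∈ U, Form.SmoothAt e.bar y := fun y hy => e.smoothAt_bar hy
  have hl : ∀ x ∈ U, ∃ h : ℝ, 0 < h ∧ θ.dC x = (Complex.I * h) • wedge (e.form x) (e.bar x) :=
    fun x hx => e.exists_levi hx
  choose! h hpos hlevi using hl
  have h0 : ∀ x ∈ U, (h x : ℂ) ≠ 0 := fun x hx => Complex.ofReal_ne_zero.2 (hpos x hx).ne'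
  have sIh : ∀ x ∈ U, FunSmoothAt (fun y => Complex.I * (h y : ℂ)) x := fun x hx =>
    (e.smooth_coeff_two hU (c₀ := 0) (c₁ := 0) (fun y _ => θ.smoothAt_dC y) (fun y hy => by
      rw [hlevi y hy, Pi.zero_apply, form_zero_smul, form_zero_smul, zero_add, zero_add]) hx).2.2
  have sh : ∀ x ∈ U, FunSmoothAt (fun y => (h y : ℂ)) x := by
    intro x hx
    have := (funSmoothAt_const (-Complex.I) x).mul (sIh x hx)
    refine FunSmoothAt.congr hU (fun y _ => ?_) hx this
    linear_combination (h y : ℂ) * Complex.I_mul_I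
  have sda : ∀ y ∈ U, Form.SmoothAt (Form.d e.form) y := fun y hy => Form.SmoothAt.d hU sa hy
  have hda : ∀ x ∈ U, ∃ p q r : ℂ, Form.d e.form x = p • wedge (θ.toC x) (e.form x) +
      q • wedge (θ.toC x) (e.bar x) + r • wedge (e.form x) (e.bar x) :=
    fun x hx => e.expand_two hx _
  choose! p q r hda using hda
  have sda' := fun x hx => e.smooth_coeff_two hU sda hda (x := x) hx
  have hdh : ∀ x ∈ U, ∃ s₀ s₁ s₂ : ℂ, dFun (fun y => (h y : ℂ)) x =
      s₀ • θ.toC x + s₁ • e.form x + s₂ • e.bar x := fun x hx => e.expand_one hx _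
  choose! s₀ s₁ s₂ hdh using hdh
  have sdh := fun x hx =>
    e.smooth_coeff_one hU (fun y hy => SmoothAt.dFun hU sh hy) hdh (x := x) hx
  have hs2 : ∀ x ∈ U, s₂ x = conj (s₁ x) := by
    intro x hx
    have := TanakaWebster.conj_dFun_ofReal (sh x hx)
    rw [hdh x hx, TanakaWebster.conj_expand] at this
    exact (e.coeff_one_unique hx this).2.2.symm
  -- The component `-p` of the connection along `θ` is dictated by `dθ¹`, so its compatibility with
  -- the metric is not a choice; it is the content of `d(dθ) = 0`.
  have hs0 : ∀ x ∈ U, s₀ x + h x * (p x + conj (p x)) = 0 := by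
    intro x hx
    have h1 : Form.d θ.dC x = 0 := by
      rw [show θ.dC = Form.d θ.toC from funext fun y => (θ.d_toC y).symm]
      exact d_d isOpen_univ (fun y _ => θ.smoothAt_toC y) (mem_univ x)
    rw [d_congr hU (γ := fun y => wedge ((Complex.I * (h y : ℂ)) • e.form y) (e.bar y))
      (fun y hy => by rw [hlevi y hy, wedge_smul_left]) hx,
      d_wedge (Form.SmoothAt.smul (sIh x hx) (sa x hx)) (sb x hx),
      d_smul (sIh x hx) (sa x hx), dFun_mul (funSmoothAt_const _ x) (sh x hx), dFun_const,
      form_smul_zero, zero_add, e.d_bar hx, hda x hx, hdh x hx, conjForm_add, conjForm_add,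
      conjForm_smul, conjForm_smul, conjForm_smul, conjForm_wedge, conjForm_wedge, conjForm_wedge,
      θ.conj_toC, e.conj_form, e.conj_bar, levi_algebra (tangentBasis x)] at h1
    have h2 := e.eq_of_smul_vol hx (h1.trans (form_zero_smul _).symm)
    refine (mul_eq_zero.1 (?_ : Complex.I * _ = 0)).resolve_left Complex.I_ne_zero
    linear_combination h2
  -- This solves the `θ¹` component `h (w₁ + conj r) = s₁` of the metric condition; the `θ^1̄`
  -- component is its conjugate.
  set w₁ : M → ℂ := fun x => (h x : ℂ)⁻¹ * s₁ x + -conj (r x) with hw1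
  set γ : Form M ℂ 1 := fun x => (-p x) • θ.toC x + w₁ x • e.form x + r x • e.bar x with hγ
  have sγ : ∀ x ∈ U, Form.SmoothAt γ x := by
    intro x hx
    obtain ⟨sp, -, sr⟩ := sda' x hx
    obtain ⟨-, ss1, -⟩ := sdh x hx
    exact ((Form.SmoothAt.smul sp.neg (θ.smoothAt_toC x)).add
      (Form.SmoothAt.smul ((((sh x hx).inv (h0 x hx)).mul ss1).add sr.conj.neg) (sa x hx))).add
      (Form.SmoothAt.smul sr (sb x hx))
  have hmetric : ∀ x ∈ U, (h x : ℂ) • γ x + (h x : ℂ) • conjForm (γ x) =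
      dFun (fun y => (h y : ℂ)) x := by
    intro x hx
    have e0 : s₀ x = (h x : ℂ) * (-p x) + h x * (-conj (p x)) := by
      linear_combination hs0 x hx
    have e1 : s₁ x = (h x : ℂ) * w₁ x + h x * conj (r x) := by
      rw [hw1]
      field_simp [h0 x hx]
      ring
    rw [hdh x hx, hγ]
    simp only [TanakaWebster.conj_expand]
    rw [hs2 x hx, e0, e1]
    simp only [map_neg, map_add, map_mul, Complex.conj_ofReal, Complex.conj_conj]
    module
  have sdγ : ∀ y ∈ U, Form.SmoothAt (Form.d γ) y := fun y hy => Form.SmoothAt.d hU sγ hy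
  have hdγ : ∀ x ∈ U, ∃ k l m : ℂ, Form.d γ x = k • wedge (θ.toC x) (e.form x) +
      l • wedge (θ.toC x) (e.bar x) + m • wedge (e.form x) (e.bar x) :=
    fun x hx => e.expand_two hx _
  choose! k l m hdγ using hdγ
  have sm : ∀ x ∈ U, FunSmoothAt m x := fun x hx => (e.smooth_coeff_two hU sdγ hdγ hx).2.2
  -- `dγ` is imaginary and so is `θ¹ ∧ θ^1̄`, hence the coefficient `m = Rh` is real and `R` can be
  -- taken real-valued.
  have hm : ∀ x ∈ U, conj (m x) = m x := by
    intro x hx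
    have h1 := conj_d_of_metric hU sh h0 sγ hmetric hx
    rw [hdγ x hx, conjForm_add, conjForm_add, conjForm_smul, conjForm_smul, conjForm_smul,
      conjForm_wedge, conjForm_wedge, conjForm_wedge, θ.conj_toC, e.conj_form, e.conj_bar,
      imaginary_algebra (tangentBasis x)] at h1
    have h2 := (e.coeff_two_unique hx (d₀ := 0) (d₁ := 0) (d₂ := 0)
      (h1.trans (by simp only [form_zero_smul, add_zero]))).2.2
    exact (sub_eq_zero.1 h2).symm
  have hR : ∀ x ∈ U, (((m x).re / h x : ℝ) : ℂ) = m x * (h x : ℂ)⁻¹ := by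
    intro x hx
    rw [Complex.ofReal_div, Complex.conj_eq_iff_re.1 (hm x hx), div_eq_mul_inv]
  have hZ : ∀ x, ∃ Z Zbar : ℂ ⊗[ℝ] TangentSpace (𝓡 3) x, x ∈ U →
      (ext (θ.toC x) Z = 0 ∧ ext (e.form x) Z = 1 ∧ ext (e.bar x) Z = 0) ∧
      (ext (θ.toC x) Zbar = 0 ∧ ext (e.form x) Zbar = 0 ∧ ext (e.bar x) Zbar = 1) := by
    intro x
    by_cases hx : x ∈ U
    · obtain ⟨Z, Zbar, h1⟩ := e.exists_frame hx
      exact ⟨Z, Zbar, fun _ => h1⟩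
    · exact ⟨0, 0, fun h1 => absurd h1 hx⟩
  choose Z Zbar hZ using hZ
  -- `A` is chosen so that `h⁻¹ Ā = q`, the `θ ∧ θ^1̄` component of `dθ¹`.
  refine ⟨{ h := h, Z := Z, Zbar := Zbar, conn := γ, A := fun x => h x * conj (q x),
            R := fun x => (m x).re / h x
            h_smooth := (funSmoothOn_iff hU).2 sh
            h_pos := hpos
            levi := hlevi
            Z_dual := fun x hx => (hZ x hx).1
            Zbar_dual := fun x hx => (hZ x hx).2
            conn_smooth := sγ
            A_smooth := (funSmoothOn_iff hU).2 fun x hx => (sh x hx).mul (sda' x hx).2.1.conj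
            structure_eq := fun x hx => ?_
            metric := hmetric
            R_smooth := (funSmoothOn_iff hU).2 fun x hx =>
              FunSmoothAt.congr hU hR hx ((sm x hx).mul ((sh x hx).inv (h0 x hx)))
            curvature := fun x hx => ⟨k x • e.form x + l x • e.bar x, ?_⟩ }⟩
  · rw [map_mul, Complex.conj_ofReal, Complex.conj_conj, inv_mul_cancel_left₀ (h0 x hx), hda x hx]
    exact structure_algebra (tangentBasis x) _ _ _ _ _ _ _
  · rw [hR x hx, inv_mul_cancel_right₀ (h0 x hx), hdγ x hx, wedge_add_right, wedge_smul_right,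
      wedge_smul_right]
    exact add_comm _ _

end ContactForm.AdmissibleCoframe

end TanakaWebsterExistence

/-! ### Local coframes, the Poincaré lemma and construction of closed sections -/

section LocalExistence

open Filter Topology

variable {M : Type*} [TopologicalSpace M] [ChartedSpace E3 M] [IsManifold (𝓡 3) ∞ M]

/-- The expression of a smooth vector field in a chart is smooth. -/
theorem VField.SmoothOn.in_chart {X : VField M} {U : Set M} (hU : IsOpen U)
    (hX : VField.SmoothOn X U) {p : M} (hp : p ∈ U) :
    ContDiffAt ℝ ∞ (fun y => chartD p (chartInv p y)
      (show E3 from X (chartInv p y))) (chartMap p p) := by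
  have h1 := (Bundle.contMDiffAt_section p).1 ((hX p hp).contMDiffAt (hU.mem_nhds hp))
  have h2 : ContMDiffAt (𝓡 3) 𝓘(ℝ, E3) ∞ (fun x => chartD p x (show E3 from X x)) p := by
    refine h1.congr_of_eventuallyEq ?_
    filter_upwards [chart_source_mem_nhds E3 p] with x hx
    -- The trivialization of the tangent bundle at `p` acts on fibres as the derivative of the chart
    -- at `p`.
    have h3 := TangentBundle.continuousLinearMapAt_trivializationAt (I := 𝓡 3) hx
    have h4 := (trivializationAt E3 (TangentSpace (𝓡 3)) p).continuousLinearMapAt_apply_of_mem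
      (R := ℝ) (b := x) (by rwa [TangentBundle.trivializationAt_baseSet]) (X x)
    rw [← h4, h3]
    rfl
  have h5 : ContMDiffAt 𝓘(ℝ, E3) (𝓡 3) ∞ (chartInv p) (chartMap p p) := by
    have := contMDiffWithinAt_extChartAt_symm_range (I := 𝓡 3) (n := ∞) p (mem_extChartAt_target p)
    rwa [ModelWithCorners.range_eq_univ, contMDiffWithinAt_univ] at this
  refine (ContMDiffAt.comp (chartMap p p) (g := fun x => chartD p x (show E3 from X x)) ?_ h5).contDiffAt
  rwa [chartInv_chartMap (mem_extChartAt_source p)]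

theorem Form.SmoothAt.contract {k : ℕ} {X : VField M} {U : Set M} (hU : IsOpen U)
    (hX : VField.SmoothOn X U) {p : M} (hp : p ∈ U) {β : Form M ℂ (k + 1)} (hβ : Form.SmoothAt β p) :
    Form.SmoothAt (fun x => CR.contract (X x) (β x)) p := by
  refine contDiffAt_form_iff.2 fun v => ?_
  have h1 := contDiffAt_form_apply_apply hβ (v := fun i y =>
    Fin.cases (motive := fun _ => E3) (chartD p (chartInv p y) (show E3 from X (chartInv p y)))
      (fun j => v j) i) (by
    intro i
    induction i using Fin.cases with
    | zero => exact hX.in_chart hU hp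
    | succ j => exact contDiffAt_const)
  refine h1.congr_of_eventuallyEq ?_
  filter_upwards [eventually_chart (mem_extChartAt_target p)] with y hy
  rw [inChart_apply, inChart_apply]
  refine (contract_apply _ _ _).trans (form_congr_point β rfl (funext fun i => ?_))
  induction i using Fin.cases with
  | zero =>
    have := chartInvD_chartD (q := chartInv p y) ((extChartAt (𝓡 3) p).map_target hy)
      (show E3 from X (chartInv p y))
    rw [chartMap_chartInv hy] at this
    exact this.symm
  | succ j => rfl

variable {S : CRStructure M}

/-- Admissible coframes exist locally. -/
theorem ContactForm.exists_admissibleCoframe (θ : ContactForm S) (p : M) :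
    ∃ U : Set M, IsOpen U ∧ p ∈ U ∧ Nonempty (θ.AdmissibleCoframe U) := by
  classical
  obtain ⟨U, hU, hpU, X, Y, hX, hY, hXY⟩ := S.smooth_H p
  have hmem : ∀ x ∈ U, ∀ v, v ∈ S.H x ↔ ∃ a b : ℝ, a • X x + b • Y x = v := by
    intro x hx v
    rw [← (hXY x hx).2, Submodule.mem_span_pair]
  have hXH : ∀ x ∈ U, X x ∈ S.H x := fun x hx => (hmem x hx _).2 ⟨1, 0, by simp⟩
  have hX0 : ∀ x ∈ U, X x ≠ 0 := fun x hx => by simpa using (hXY x hx).1.ne_zero 0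
  let X' : VField M := fun x => if h : X x ∈ S.H x then (S.J x ⟨X x, h⟩ : TangentSpace (𝓡 3) x) else 0
  have hX'e : ∀ x (h : X x ∈ S.H x), (S.J x ⟨X x, h⟩ : TangentSpace (𝓡 3) x) = X' x := fun x h => by
    simp [X', h]
  have hX' : VField.SmoothOn X' U :=
    S.smooth_J U X X' hU hX fun x hx => ⟨hXH x hx, hX'e x (hXH x hx)⟩
  -- `X` and `J X` span `H`
  have hspan : ∀ x ∈ U, ∀ v : S.H x, ∃ a b : ℝ, (v : TangentSpace (𝓡 3) x) = a • X x + b • X' x ∧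
      (S.J x v : TangentSpace (𝓡 3) x) = a • X' x + (-b) • X x := by
    intro x hx v
    set ex : S.H x := ⟨X x, hXH x hx⟩ with hex
    have hJ : ((S.J x ex : S.H x) : TangentSpace (𝓡 3) x) = X' x := hX'e x (hXH x hx)
    obtain ⟨c, d, hcd⟩ := (hmem x hx _).1 (S.J x ex).2
    -- If `JX` were `cX`, then `J² = -1` would give `c² + 1 = 0` for a real number `c`.
    have hd : d ≠ 0 := by
      rintro rfl
      have h1 : S.J x ex = c • ex := Subtype.ext (by rw [← hcd, zero_smul, add_zero]; rfl)
      have h2 := S.J_sq x ex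
      rw [h1, map_smul, h1, smul_smul] at h2
      have h3 : (c * c + 1) • ex = 0 := by rw [add_smul, h2, one_smul, neg_add_cancel]
      rcases smul_eq_zero.1 h3 with h4 | h4
      · nlinarith [mul_self_nonneg c]
      · exact hX0 x hx (congrArg Subtype.val h4)
    obtain ⟨m, n, hmn⟩ := (hmem x hx _).1 v.2
    have hv : v = (m - n / d * c) • ex + (n / d) • S.J x ex := by
      apply Subtype.ext
      change (v : TangentSpace (𝓡 3) x) = (m - n / d * c) • X x + (n / d) • (S.J x ex : TangentSpace (𝓡 3) x)
      rw [← hmn, ← hcd, smul_add, smul_smul, smul_smul, div_mul_cancel₀ n hd]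
      module
    refine ⟨m - n / d * c, n / d, ?_, ?_⟩
    · conv_lhs => rw [hv]
      rw [← hJ]
      rfl
    · conv_lhs => rw [hv]
      rw [map_add, map_smul, map_smul, S.J_sq, ← hJ]
      simp [hex]
  have hB : ∀ x ∈ U, (0 : ℝ) < Form.d θ.form x ![X x, X' x] := by
    intro x hx
    have := θ.pos x ⟨X x, hXH x hx⟩ (fun h => hX0 x hx (congrArg Subtype.val h))
    rw [hX'e x (hXH x hx)] at this
    exact this
  -- With `X' = JX`, the form `-dθ(JX, ·) + i dθ(X, ·)` is smooth, vanishes on `T` because `T ⌟ dθ =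
  -- 0`, and satisfies `α(JX) = iα(X)` with `α(X) = dθ(X, JX) > 0`. No smoothness of the Reeb field
  -- is needed.
  let α : Form M ℂ 1 := fun x => (-1 : ℂ) • contract (X' x) (θ.dC x) + Complex.I • contract (X x) (θ.dC x)
  have hα : ∀ x v, α x ![v] = -θ.dC x ![X' x, v] + Complex.I * θ.dC x ![X x, v] := by
    intro x v
    simp only [α, ContinuousAlternatingMap.add_apply, ContinuousAlternatingMap.smul_apply,
      contract_apply, smul_eq_mul]
    ring
  have hαX : ∀ x, α x ![X x] = θ.dC x ![X x, X' x] := by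
    intro x
    rw [hα, form_self, form_swap _ (X x) (X' x)]
    ring
  have hαX' : ∀ x, α x ![X' x] = Complex.I * θ.dC x ![X x, X' x] := by
    intro x
    rw [hα, form_self]
    ring
  have h10 : ∀ x ∈ U, S.Is10 x (α x) := by
    intro x hx
    refine CRStructure.is10_iff.2 fun v => ?_
    obtain ⟨a, b, hv, hJv⟩ := hspan x hx v
    rw [hv, hJv]
    simp only [form_one_add, form_one_smul, hαX, hαX', Complex.real_smul]
    push_cast
    linear_combination (-(b : ℂ) * θ.dC x ![X x, X' x]) * Complex.I_mul_I
  refine ⟨U, hU, hpU, ⟨{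
    form := α
    smooth := fun x hx => ?_
    is10 := h10
    basis := fun x hx => ?_
    reeb := fun x hx => ?_ }⟩⟩
  · exact (Form.SmoothAt.smul (funSmoothAt_const _ x)
      (Form.SmoothAt.contract hU hX' hx (θ.smoothAt_dC x))).add
      (Form.SmoothAt.smul (funSmoothAt_const _ x)
      (Form.SmoothAt.contract hU hX hx (θ.smoothAt_dC x)))
  · refine ⟨_, Submodule.subset_span ⟨⟨X x, hXH x hx⟩, rfl⟩, ?_⟩
    rw [map_sub, ext_tmul, ext_tmul, hX'e x (hXH x hx), hαX', hαX]
    have h1 : θ.dC x ![X x, X' x] ≠ 0 := Complex.ofReal_ne_zero.2 (hB x hx).ne'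
    have h2 : 1 * θ.dC x ![X x, X' x] - Complex.I * (Complex.I * θ.dC x ![X x, X' x]) =
        2 * θ.dC x ![X x, X' x] := by
      linear_combination (-θ.dC x ![X x, X' x]) * Complex.I_mul_I
    rw [h2]
    exact mul_ne_zero two_ne_zero h1
  · have hr : ∀ w, θ.dC x ![w, θ.reeb x] = 0 := fun w => by
      rw [form_swap]
      change -((Form.d θ.form x ![θ.reeb x, w] : ℝ) : ℂ) = 0
      rw [θ.d_reeb]
      simp
    rw [hα, hr, hr]
    simp

theorem inChart_injective {k : ℕ} {α β : Form M ℂ k} {p x : M}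
    (hx : x ∈ (extChartAt (𝓡 3) p).source)
    (h : Form.inChart α p (chartMap p x) = Form.inChart β p (chartMap p x)) : α x = β x := by
  ext v
  have h1 := congrArg (fun γ => γ fun i => chartD p x (v i)) h
  simp only [inChart_apply] at h1
  calc α x v = _ := form_congr_point α (chartInv_chartMap hx).symm
        (funext fun i => (chartInvD_chartD hx _).symm)
    _ = _ := h1
    _ = β x v := form_congr_point β (chartInv_chartMap hx) (funext fun i => chartInvD_chartD hx _)

/-- The Poincaré lemma for one-forms. The neighborhood is connected, in the sense that functions
with vanishing differential are constant on it. -/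
theorem exists_primitive {γ : Form M ℂ 1} {U : Set M} (hU : IsOpen U)
    (hγ : ∀ x ∈ U, Form.SmoothAt γ x) (hd : ∀ x ∈ U, Form.d γ x = 0) {p : M} (hp : p ∈ U) :
    ∃ W : Set M, IsOpen W ∧ p ∈ W ∧ W ⊆ U ∧
      (∃ v : M → ℂ, (∀ x ∈ W, FunSmoothAt v x) ∧ ∀ x ∈ W, dFun v x = γ x) ∧
      ∀ f : M → ℂ, (∀ x ∈ W, FunSmoothAt f x) → (∀ x ∈ W, dFun f x = 0) → ∀ x ∈ W, f x = f p := by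
  have hpt := mem_extChartAt_target (I := 𝓡 3) p
  have hps := mem_extChartAt_source (I := 𝓡 3) p
  have hpp : chartInv p (chartMap p p) ∈ U := by rwa [chartInv_chartMap hps]
  obtain ⟨ε, hε, hball⟩ := Metric.eventually_nhds_iff_ball.1
    ((eventually_chart hpt).and (eventually_chartInv_mem hpt hU hpp))
  -- The neighborhood corresponds to a ball in the chart: convexity provides the primitive,
  -- connectedness the constancy statement.
  set B := Metric.ball (chartMap p p) ε with hBdef
  have hBo : IsOpen B := Metric.isOpen_ball
  set W : Set M := (extChartAt (𝓡 3) p).source ∩ chartMap p ⁻¹' B with hW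
  have hWo : IsOpen W :=
    (continuousOn_extChartAt (I := 𝓡 3) p).isOpen_inter_preimage (isOpen_extChartAt_source p) hBo
  have hWB : ∀ y ∈ B, chartInv p y ∈ W := fun y hy =>
    ⟨(extChartAt (𝓡 3) p).map_target (hball y hy).1, by
      rw [mem_preimage, chartMap_chartInv (hball y hy).1]; exact hy⟩
  have hpB : chartMap p p ∈ B := Metric.mem_ball_self hε
  have hWU : W ⊆ U := fun x hx => by
    have := (hball _ hx.2).2
    rwa [chartInv_chartMap hx.1] at this
  refine ⟨W, hWo, ⟨hps, hpB⟩, hWU, ?_, ?_⟩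
  · set G := Form.inChart γ p with hG
    have sG : ∀ y ∈ B, ContDiffAt ℝ ∞ G y := fun y hy =>
      Form.SmoothAt.inChart (hball y hy).1 (hγ _ (hball y hy).2)
    have dG : ∀ y ∈ B, extDeriv G y = 0 := by
      intro y hy
      rw [← inChart_d (hball y hy).1 (hγ _ (hball y hy).2)]
      ext v
      rw [inChart_apply, hd _ (hball y hy).2]
      rfl
    let g : E3 → E3 →L[ℝ] ℂ := fun y =>
      (ContinuousAlternatingMap.ofSubsingleton ℝ E3 ℂ (0 : Fin 1)).symm (G y)
    have hg : ∀ y v, g y v = G y ![v] := by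
      intro y v
      have : (fun _ : Fin 1 => v) = ![v] := by ext i; simp
      rw [← this]
      rfl
    have sg : ContDiffOn ℝ ∞ g B := by
      refine contDiffOn_clm_apply.2 fun v y hy => ?_
      simp_rw [hg]
      exact (contDiffAt_form_apply (sG y hy) _).contDiffWithinAt
    have dg : DifferentiableOn ℝ g B := sg.differentiableOn (by simp)
    -- Closedness of a one-form is symmetry of the derivative of the corresponding covector field.
    obtain ⟨f, hf⟩ := (convex_ball (chartMap p p) ε).exists_forall_hasFDerivAt_of_fderiv_symmetric
      hBo dg (by
        intro y hy v w
        have h1 : ∀ v w, fderiv ℝ g y v w = fderiv ℝ (fun z => G z ![w]) y v := by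
          intro v w
          have h2 := ((dg.differentiableAt (hBo.mem_nhds hy)).hasFDerivAt.clm_apply
            (hasFDerivAt_const w y)).fderiv
          simp_rw [hg] at h2
          rw [h2]
          simp
        have h3 := extDeriv_one_apply ((sG y hy).differentiableAt (by simp)) v w
        rw [dG y hy, ← h1, ← h1] at h3
        exact (sub_eq_zero.1 h3.symm))
    have sf : ContDiffOn ℝ ∞ f B := by
      refine (contDiffOn_infty_iff_fderiv_of_isOpen hBo).2
        ⟨fun y hy => (hf y hy).differentiableAt.differentiableWithinAt, ?_⟩
      exact sg.congr fun y hy => (hf y hy).fderiv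
    have sv : ∀ x ∈ W, FunSmoothAt (fun x => f (chartMap p x)) x := by
      intro x hx
      have h1 : ContDiffAt ℝ ∞ f (chartMap p x) := (sf _ hx.2).contDiffAt (hBo.mem_nhds hx.2)
      exact h1.contMDiffAt.comp x (contMDiffAt_extChartAt' (by rw [← extChartAt_source (𝓡 3)]; exact hx.1))
    refine ⟨fun x => f (chartMap p x), sv, fun x hx => inChart_injective hx.1 ?_⟩
    have hxt := (extChartAt (𝓡 3) p).map_source hx.1
    rw [inChart_dFun hxt (by rw [chartInv_chartMap hx.1]; exact sv x hx)]
    have he : (fun y => f (chartMap p (chartInv p y))) =ᶠ[𝓝 (chartMap p x)] f := by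
      filter_upwards [hBo.mem_nhds hx.2] with y hy
      rw [chartMap_chartInv (hball y hy).1]
    ext v
    have e : v = ![v 0] := by ext i; fin_cases i; rfl
    rw [e, flatDFun_apply, he.fderiv_eq, (hf _ hx.2).fderiv, hg]
  · intro f sf hf x hx
    have key : ∀ y ∈ B, ContDiffAt ℝ ∞ (fun y => f (chartInv p y)) y := fun y hy =>
      FunSmoothAt.in_chart (hball y hy).1 (sf _ (hWB y hy))
    have h1 := hBo.is_const_of_fderiv_eq_zero (𝕜 := ℝ) (f := fun y => f (chartInv p y))
      (convex_ball _ _).isPreconnected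
      (fun y hy => ((key y hy).differentiableAt (by simp)).differentiableWithinAt)
      (fun y hy => by
        ext v
        rw [← flatDFun_apply, ← inChart_dFun (hball y hy).1 (sf _ (hWB y hy)), inChart_apply,
          hf _ (hWB y hy)]
        rfl) hx.2 hpB
    simpa only [chartInv_chartMap hx.1, chartInv_chartMap hps] using h1

/-- If `θ` is pseudo-Einstein, then there is locally a closed nowhere vanishing section of the canonical bundle
with respect to which `θ` is volume-normalized. -/
theorem ContactForm.PseudoEinstein.exists_section {θ : ContactForm S} (hθ : θ.PseudoEinstein)
    (p : M) : ∃ U : Set M, IsOpen U ∧ p ∈ U ∧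
      ∃ ξ : Form M ℂ 2, S.IsCanonicalSection U ξ ∧ (∀ x ∈ U, ξ x ≠ 0) ∧
        (∀ x ∈ U, Form.d ξ x = 0) ∧ θ.VolumeNormalizedOn U ξ := by
  obtain ⟨U, hU, hpU, ⟨e⟩⟩ := θ.exists_admissibleCoframe p
  obtain ⟨D⟩ := e.exists_tanakaWebster hU
  have sR := (funSmoothOn_iff hU).1 D.R_smooth
  have sh := (funSmoothOn_iff hU).1 D.h_smooth
  obtain ⟨W, hW, hpW, hWU, ⟨v, sv, hv⟩, hconst⟩ := exists_primitive (γ := D.curvForm) hU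
    (fun x hx => (D.conn_smooth x hx).add (Form.SmoothAt.smul
      ((funSmoothAt_const _ x).mul (sR x hx)) (θ.smoothAt_toC x)))
    (θ.pseudoEinstein_iff.1 hθ U hU e D) hpU
  -- `h exp(-v - v̄)` is constant
  set F : M → ℂ := fun x => D.h x * Complex.exp (-(v x + conj (v x))) with hF
  have sE : ∀ x ∈ W, FunSmoothAt (fun x => -(v x + conj (v x))) x := fun x hx =>
    ((sv x hx).add (sv x hx).conj).neg
  -- The term `iRθ` is imaginary and drops out of `dv + dv̄`, leaving `ω + ω̄`, which equals `dh /
  -- h` by metric compatibility.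
  have hdE : ∀ x ∈ W, dFun (fun x => -(v x + conj (v x))) x =
      (-1 : ℂ) • (D.conn x + conjForm (D.conn x)) := by
    intro x hx
    have s1 : FunSmoothAt (fun y => v y + conj (v y)) x := (sv x hx).add (sv x hx).conj
    rw [dFun_congr hW (g := fun y => (-1 : ℂ) * (v y + conj (v y))) (fun y _ => by ring) hx,
      dFun_mul (funSmoothAt_const _ x) s1, dFun_const, form_smul_zero, zero_add,
      dFun_add (sv x hx) (sv x hx).conj, dFun_conj (sv x hx), hv x hx,
      ContactForm.TanakaWebster.curvForm, conjForm_add, conjForm_smul, θ.conj_toC, map_mul,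
      Complex.conj_I, Complex.conj_ofReal]
    module
  have hFc : ∀ x ∈ W, F x = F p := by
    refine hconst F (fun x hx => (sh x (hWU hx)).mul (sE x hx).cexp) fun x hx => ?_
    rw [hF, dFun_mul (sh x (hWU hx)) (sE x hx).cexp, dFun_cexp (sE x hx), hdE x hx,
      ← D.metric x (hWU hx)]
    have e0 : (0 : TangentSpace (𝓡 3) x [⋀^Fin 1]→L[ℝ] ℂ) = (0 : ℂ) • D.conn x :=
      (form_zero_smul _).symm
    rw [e0]
    module
  set C : ℝ := D.h p * Real.exp (-(2 * (v p).re)) with hC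
  have hCpos : 0 < C := mul_pos (D.h_pos p hpU) (Real.exp_pos _)
  have hFp : F p = C := by
    rw [hF, hC]
    simp only [Complex.add_conj]
    push_cast
    rfl
  -- The factor `√C` turns `h = C e^{v + v̄}` into `h = u ū`.
  set u : M → ℂ := fun x => (Real.sqrt C : ℂ) * Complex.exp (v x) with hu
  have hc0 : (Real.sqrt C : ℂ) ≠ 0 := Complex.ofReal_ne_zero.2 (Real.sqrt_pos.2 hCpos).ne'
  have su : ∀ x ∈ W, FunSmoothAt u x := fun x hx => (funSmoothAt_const _ x).mul (sv x hx).cexp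
  have hdu : ∀ x ∈ W, dFun u x = u x • D.curvForm x := by
    intro x hx
    rw [hu, dFun_mul (funSmoothAt_const _ x) (sv x hx).cexp, dFun_const, form_smul_zero, zero_add,
      dFun_cexp (sv x hx), hv x hx, smul_smul]
  have hnorm : ∀ x ∈ W, (D.h x : ℂ) = u x * conj (u x) := by
    intro x hx
    have h1 := hFc x hx
    rw [hFp, hF] at h1
    have h2 : (D.h x : ℂ) = C * Complex.exp (v x + conj (v x)) := by
      rw [← h1, mul_assoc, ← Complex.exp_add, neg_add_cancel, Complex.exp_zero, mul_one]
    have h3 : ((Real.sqrt C : ℝ) : ℂ) * (Real.sqrt C : ℝ) = C := by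
      rw [← Complex.ofReal_mul, Real.mul_self_sqrt hCpos.le]
    rw [h2, hu, map_mul, Complex.conj_ofReal, ← Complex.exp_conj, Complex.exp_add]
    linear_combination (-Complex.exp (v x) * Complex.exp (conj (v x))) * h3
  refine ⟨W, hW, hpW, fun x => wedge (u x • θ.toC x) (e.form x), ⟨fun x hx => ?_, fun x hx => ?_⟩,
    fun x hx h => ?_, fun x hx => ?_, fun x hx => ?_⟩
  · exact (Form.SmoothAt.smul (su x hx) (θ.smoothAt_toC x)).wedge_one (e.smoothAt_form (hWU hx))
  · exact (e.mem_K_iff (hWU hx)).2 ⟨u x, rfl⟩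
  · change wedge (u x • θ.toC x) (e.form x) = 0 at h
    rw [wedge_smul_left] at h
    exact e.wedge_ne_zero (hWU hx)
      (form_smul_eq_zero (mul_ne_zero hc0 (Complex.exp_ne_zero _)) h)
  · obtain ⟨w₀, w₁, w₂, hw⟩ := e.expand_one (hWU hx) (D.conn x)
    -- From `du = u(ω + iRθ)`: the added term affects only the `θ` component, so `u_1̄ = u ω_1̄` and
    -- the section is closed.
    have h1 : dFun u x = (u x * (w₀ + Complex.I * D.R x)) • θ.toC x + (u x * w₁) • e.form x +
        (u x * w₂) • e.bar x := by
      rw [hdu x hx, ContactForm.TanakaWebster.curvForm, hw]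
      module
    rw [D.d_section (hWU hx) (su x hx) h1 hw, sub_self, form_zero_smul]
  · exact (e.volume_iff (hWU hx) (D.levi x (hWU hx)) (u x)).2 (hnorm x hx)

end LocalExistence

end CR

end

theorem mainTheorem6 {M : Type*} [TopologicalSpace M]
    [ChartedSpace (EuclideanSpace ℝ (Fin 3)) M] [IsManifold (𝓡 3) ∞ M]
    (S : CR.CRStructure M) (θ : CR.ContactForm S) :
    (θ.PseudoEinstein ↔
      ∀ p : M, ∃ U : Set M, IsOpen U ∧ p ∈ U ∧
        ∃ ξ : CR.Form M ℂ 2, S.IsCanonicalSection U ξ ∧ (∀ x ∈ U, ξ x ≠ 0) ∧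
          (∀ x ∈ U, CR.Form.d ξ x = 0) ∧ θ.VolumeNormalizedOn U ξ) ∧
    (θ.PseudoEinstein ↔
      ∀ U : Set M, IsOpen U → ∀ (e : θ.AdmissibleCoframe U) (D : θ.TanakaWebster e),
        ∀ x ∈ U, CR.Form.d D.curvForm x = 0) := by
  exact ⟨⟨fun h p => h.exists_section p, fun H => θ.pseudoEinstein_of_sections H⟩,
    θ.pseudoEinstein_iff⟩
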